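/- **Setting.** Let $T$ be an endofunctor on sets and $\Lambda$ a set of unary modalities, each $\heartsuit\in\Lambda$ interpreted by a monotone predicate lifting for $T$ (write $t\models\heartsuit A$ for $t\in[\![\heartsuit]\!]_X(A)$, $t\in TX$, $A\subseteq X$) and represented by a finite string. Conjunctive formulas are $\phi::=\top\mid\phi\wedge\phi\mid\heartsuit\phi$, interpreted as usual at states of $T$-coalgebras; a fragment is a set $\mathcal L$ of conjunctive formulas. A *simulation* $S$ from $(X,\xi)$ to $(Y,\zeta)$ is a relation such that $xSy$ and $\xi(x)\models\heartsuit A$ imply $\zeta(y)\models\heartsuit S[A]$. A pointed coalgebra $(C,r)$ is a *wsi model* of $\phi$ if, for all pointed coalgebras $(D,y)$, $y\models\phi$ iff some simulation from $C$ to $D$ relates $r$ to $y$. A *conjunctive one-step formula* over a set $V$ of variables is a finite conjunction $\psi=\bigwedge_i\heartsuit_i a_i$ with $a_i\in V$. A *one-step model* is $(X,\tau,t)$ with $\tau:V\to\mathcal P(X)$, $t\in TX$; it satisfies $\psi$ if $t\models\heartsuit_i\tau(a_i)$ for all $i$. It is a *one-step wsi model* of $\psi$ if it satisfies $\psi$ and,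 for every one-step model $(Y,\theta,s)$ satisfying $\psi$, $t\models\heartsuit A$ implies $s\models\heartsuit S[A]$, where $xSy$ iff $\{p: x\in\tau(p)\}\subseteq\{p:y\in\theta(p)\}$. It is *linear* if $|\tau(a_i)|\le1$ for all $i$, and *$k$-bounded* if each $x\in X$ satisfies at most $k$ of the variables of $\psi$. Every conjunctive formula is, up to associativity, commutativity, idempotence and units, of the form $\phi=\bigwedge_i\heartsuit_i\chi_i$; put $\phi^*=\bigwedge_i\heartsuit_i a_i$, where $a_i$ is a variable standing for $\rho(a_i)=\chi_i$. Fix one of two conventions: one variable for each argument (so $a_i=a_j$ iff $\chi_i=\chi_j$) or one for each atom (so $a_i=a_j$ iff $\heartsuit_i\chi_i=\heartsuit_j\chi_j$); the results hold for both. The formulas *relevant* for $\mathcal L$ are those in $\mathcal L$ and, recursively, the finite conjunctions (possibly empty or with repetitions) of arguments $\chi_i$ of relevant ones. $\mathcal L$ *admits linear ($k$-bounded) one-step wsi models* if $\phi^*$ has such a model for each $\phi$ relevant for $\mathcal L$. $\Lambda$ *admits polynomial one-step wsi models* if there is a polynomial $p$ such that every conjunctive one-step formula $\psi$ has a one-step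 wsi model with at most $p(|\psi|)$ states. An *abstract wsi model* of $\phi$ is a finite set of states with a root, each state $y$ storing a one-step formula $\psi_y$ (over variables as above), a set $X_y$ of states and a valuation $\tau_y$ in $X_y$ of the variables of $\psi_y$, such that $\psi_{\mathrm{root}}=\phi^*$, $\psi_x=(\bigwedge\{\rho(a): x\in\tau_y(a)\})^*$ for $x\in X_y$, and for suitable $t_y\in TX_y$ each $(X_y,\tau_y,t_y)$ is a one-step wsi model of $\psi_y$ and the coalgebra with transitions $y\mapsto t_y$, pointed at the root, is a wsi model of $\phi$. $\mathcal L$ *admits polynomial wsi models* if some algorithm computes, for each $\phi\in\mathcal L$, an abstract wsi model of $\phi$ in time polynomial in $|\phi|$. A *one-step procedure* for $\mathcal L$ is a (not necessarily computable) function that returns for every $\phi$ relevant for $\mathcal L$ the part $(X,\tau)$ of a one-step wsi model of $\phi^*$, explicitly as a finite list of the sets of variables of $\phi^*$ satisfied at the states, different states satisfying different sets. **Proposition.** (a) Let $\mathcal L$ be a conjunctive fragment. (i) If $\mathcal L$ admits linear one-step wsi models, then it has a one-step procedure returning linear models; for each such procedure, abstract wsi models of the formulas in $\mathcal L$ are computable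 in polynomial time by an algorithm that may call the procedure (a call costs the size of the query and of the answer); and if presentations $(X,\tau)$ as above of linear one-step wsi models are computable in polynomial time for the formulas relevant for $\mathcal L$, then $\mathcal L$ admits polynomial wsi models. (ii) If $\mathcal L$ admits $k$-bounded one-step wsi models for some $k\in\mathbb N$, then $\mathcal L$ admits polynomial wsi models. (b) If $\Lambda$ admits polynomial one-step wsi models, then there are a polynomial $p$ and a function that is, for every $d$, a one-step procedure returning models with at most $p(|\phi^*|)$ states for the fragment $\mathcal L_d$ of conjunctive formulas of modal depth at most $d$. For each $d$: given any one-step procedure for $\mathcal L_d$ returning models of polynomially bounded size, abstract wsi models of the formulas in $\mathcal L_d$ are computable in polynomial time by an algorithm that may call the procedure; and if presentations $(X,\tau)$ of polynomially bounded size are computable in polynomial time for the formulas relevant for $\mathcal L_d$, then $\mathcal L_d$ admits polynomial wsi models. -/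

import Mathlib

namespace CoalgLogic

/-! ### Cost model

A first-order functional programming language over binary trees, with an explicit step count.
Every construct costs at least one unit, and reading a variable (that is, copying its value)
costs in addition the size of the value, so the cost of an evaluation bounds all sizes of
computed values, and polynomial cost is the usual polynomial time. -/

/-- Binary trees, the data on which programs operate. -/
inductive Dat : Type
  | nil : Dat
  | cons : Dat → Dat → Dat

/-- Number of nodes of a tree. -/
def Dat.size : Dat → ℕ
  | .nil => 1
  | .cons a b => 1 + a.size + b.size

/-- Expressions; variables are de Bruijn indices into the environment.
`matchE e n c` evaluates `e`; it continues with `n` if the value is `nil`, and with `c` if the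
value is `cons a b`, where `a` and `b` become variables `0` and `1`.
`ifEq a b e₁ e₂` compares two values; `call f e` applies the `f`-th function of the program;
`ask e` is a call of the external subroutine (oracle). -/
inductive Expr : Type
  | var : ℕ → Expr
  | nil : Expr
  | cons : Expr → Expr → Expr
  | letE : Expr → Expr → Expr
  | matchE : Expr → Expr → Expr → Expr
  | ifEq : Expr → Expr → Expr → Expr → Expr
  | call : ℕ → Expr → Expr
  | ask : Expr → Expr

/-- A program is a finite list of bodies of (mutually recursive) unary functions. -/
abbrev Program : Type := List Expr

/-- `Eval O P env e v c`: with oracle `O`, program `P` and environment `env`, the expression `e`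
evaluates to `v`, at cost `c`. -/
inductive Eval (O : Dat → Dat) (P : Program) : List Dat → Expr → Dat → ℕ → Prop
  | var {env : List Dat} {i : ℕ} {v : Dat} :
      env[i]? = some v → Eval O P env (.var i) v (1 + v.size)
  | nil {env : List Dat} : Eval O P env .nil .nil 1
  | cons {env : List Dat} {a b : Expr} {v w : Dat} {c d : ℕ} :
      Eval O P env a v c → Eval O P env b w d →
      Eval O P env (.cons a b) (.cons v w) (1 + c + d)
  | letE {env : List Dat} {a b : Expr} {v w : Dat} {c d : ℕ} :
      Eval O P env a v c → Eval O P (v :: env) b w d →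
      Eval O P env (.letE a b) w (1 + c + d)
  | matchNil {env : List Dat} {e n k : Expr} {w : Dat} {c d : ℕ} :
      Eval O P env e .nil c → Eval O P env n w d →
      Eval O P env (.matchE e n k) w (1 + c + d)
  | matchCons {env : List Dat} {e n k : Expr} {a b w : Dat} {c d : ℕ} :
      Eval O P env e (.cons a b) c → Eval O P (a :: b :: env) k w d →
      Eval O P env (.matchE e n k) w (1 + c + d)
  | ifEq {env : List Dat} {a b e₁ e₂ : Expr} {v w : Dat} {c c' d : ℕ} :
      Eval O P env a v c → Eval O P env b v c' → Eval O P env e₁ w d →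
      Eval O P env (.ifEq a b e₁ e₂) w (1 + c + c' + d)
  | ifNe {env : List Dat} {a b e₁ e₂ : Expr} {v v' w : Dat} {c c' d : ℕ} :
      Eval O P env a v c → Eval O P env b v' c' → v ≠ v' → Eval O P env e₂ w d →
      Eval O P env (.ifEq a b e₁ e₂) w (1 + c + c' + d)
  | call {env : List Dat} {f : ℕ} {e body : Expr} {v w : Dat} {c d : ℕ} :
      Eval O P env e v c → P[f]? = some body → Eval O P [v] body w d →
      Eval O P env (.call f e) w (1 + c + d)
  | ask {env : List Dat} {e : Expr} {v : Dat} {c : ℕ} :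
      Eval O P env e v c → Eval O P env (.ask e) (O v) (1 + c + (O v).size)

/-- The trivial oracle: programs run with it are ordinary programs. -/
def noOracle : Dat → Dat := fun _ => .nil

/-- Some program (with oracle `O`) computes, on every input `x ∈ D`, in time polynomial in the
size of `x`, an output `v` with `R x v`. Its main function is function number `0`. -/
def SolvesInPolyTime (O : Dat → Dat) (D : Set Dat) (R : Dat → Dat → Prop) : Prop :=
  ∃ (P : Program) (p : Polynomial ℕ), ∀ x ∈ D, ∃ (v : Dat) (c : ℕ),
    Eval O P [x] (.call 0 (.var 0)) v c ∧ c ≤ p.eval x.size ∧ R x v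

/-! ### Encodings -/

/-- Encoding of lists, given an encoding of the elements. -/
def encList {α : Type} (e : α → Dat) : List α → Dat
  | [] => .nil
  | a :: l => .cons (e a) (encList e l)

/-- Encoding of pairs, given encodings of the components. -/
def encPair {α β : Type} (e : α → Dat) (e' : β → Dat) (x : α × β) : Dat :=
  .cons (e x.1) (e' x.2)

/-! ### Syntax -/

/-- Conjunctive formulas over a set of (unary) modalities. -/
inductive Form (Mod : Type) : Type
  | top : Form Mod
  | and : Form Mod → Form Mod → Form Mod
  | mod : Mod → Form Mod → Form Mod

/-- Modal depth. -/
def Form.depth {Mod : Type} : Form Mod → ℕ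
  | .top => 0
  | .and φ ψ => max φ.depth ψ.depth
  | .mod _ φ => φ.depth + 1

/-- A conjunctive one-step formula over a set `V` of variables, i.e. a finite conjunction of
atoms `♥ a`, given as the list of its atoms `(♥, a)`. -/
abbrev OSForm (Mod V : Type) : Type := List (Mod × V)

/-- The variables that occur in a one-step formula. -/
def OSForm.vars {Mod V : Type} (φ : OSForm Mod V) : List V := φ.map Prod.snd

/-- The variables `a` used to decompose a formula `⋀ i, ♥ᵢ χᵢ` as the one-step formula
`⋀ i, ♥ᵢ aᵢ` with the substitution `aᵢ ↦ χᵢ`. The variable for the argument `χ` is `(none, χ)`;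
the variable for the atom `♥ χ` is `(some ♥, χ)`. The substitution is the second projection. -/
abbrev Var (Mod : Type) : Type := Option Mod × Form Mod

/-- Both conventions for naming variables are considered: one variable `a_χ` per argument
(`sh = true`: atoms `♥ χ` and `♥' χ` share their variable), or one variable `a_{♥χ}` per atom
(`sh = false`). -/
def mkVar {Mod : Type} (sh : Bool) (h : Mod) (χ : Form Mod) : Var Mod :=
  (if sh then none else some h, χ)

/-- The one-step formula `φ* = ⋀ i, ♥ᵢ aᵢ` of a conjunctive formula `φ = ⋀ i, ♥ᵢ χᵢ`. -/
def Form.star {Mod : Type} (sh : Bool) : Form Mod → OSForm Mod (Var Mod)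
  | .top => []
  | .and φ ψ => φ.star sh ++ ψ.star sh
  | .mod h φ => [(h, mkVar sh h φ)]

/-- The one-step formula `(⋀ B)*` of the conjunction of a finite list `B` of formulas. -/
def starConj {Mod : Type} (sh : Bool) (B : List (Form Mod)) : OSForm Mod (Var Mod) :=
  B.flatMap (Form.star sh)

/-- The formulas `χᵢ` in `φ = ⋀ i, ♥ᵢ χᵢ`. -/
def Form.args {Mod : Type} : Form Mod → List (Form Mod)
  | .top => []
  | .and φ ψ => φ.args ++ ψ.args
  | .mod _ φ => [φ]

/-- Finite conjunctions (given as lists) that are relevant for a fragment `L`: the formulas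
in `L`, and, recursively, conjunctions of arguments of top-level modalities of relevant ones.
The one-step formulas relevant for `L` are the `starConj sh B` with `Relevant L B`. -/
inductive Relevant {Mod : Type} (L : Set (Form Mod)) : List (Form Mod) → Prop
  | base {φ : Form Mod} : φ ∈ L → Relevant L [φ]
  | step {B B' : List (Form Mod)} : Relevant L B →
      (∀ χ ∈ B', ∃ φ ∈ B, χ ∈ φ.args) → Relevant L B'

/-! ### Semantics -/

/-- A similarity type `Λ` together with its interpretation over the set functor `T`: every
modality denotes a monotone predicate lifting, i.e. a monotone natural transformation
from the contravariant powerset functor to its composite with `T`. For algorithmic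
purposes, modalities are represented by data. -/
structure ModalStructure (T : Type → Type) [Functor T] where
  Mod : Type
  lift : Mod → ∀ {X : Type}, Set X → Set (T X)
  lift_natural : ∀ (h : Mod) {X Y : Type} (f : X → Y) (A : Set Y),
    lift h (f ⁻¹' A) = (fun t : T X => f <$> t) ⁻¹' lift h A
  lift_mono : ∀ (h : Mod) {X : Type} {A B : Set X}, A ⊆ B → lift h A ⊆ lift h B
  code : Mod → Dat
  code_injective : Function.Injective code

variable {T : Type → Type} [Functor T] (Λ : ModalStructure T)

namespace ModalStructure

/-- Satisfaction of conjunctive formulas in the `T`-coalgebra `(X, ξ)`. -/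
def Sat {X : Type} (ξ : X → T X) : Form Λ.Mod → X → Prop
  | .top, _ => True
  | .and φ ψ, x => Sat ξ φ x ∧ Sat ξ ψ x
  | .mod h φ, x => ξ x ∈ Λ.lift h {y | Sat ξ φ y}

/-- The relational image `S[A]`. -/
def relImage {X Y : Type} (S : X → Y → Prop) (A : Set X) : Set Y := {y | ∃ x ∈ A, S x y}

/-- `Λ`-simulations of `(X, ξ)` by `(Y, ζ)`. -/
def IsSimulation {X Y : Type} (ξ : X → T X) (ζ : Y → T Y) (S : X → Y → Prop) : Prop :=
  ∀ x y, S x y → ∀ (h : Λ.Mod) (A : Set X), ξ x ∈ Λ.lift h A → ζ y ∈ Λ.lift h (relImage S A)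

/-- The pointed coalgebra `((X, ξ), r)` is a weakly simulation-initial (wsi) model of `φ`. -/
def IsWsi {X : Type} (ξ : X → T X) (r : X) (φ : Form Λ.Mod) : Prop :=
  ∀ (Y : Type) (ζ : Y → T Y) (y : Y),
    Λ.Sat ζ φ y ↔ ∃ S : X → Y → Prop, Λ.IsSimulation ξ ζ S ∧ S r y

/-- Satisfaction of a one-step formula in the one-step model `(X, τ, t)`. -/
def OSSat {V X : Type} (τ : V → Set X) (t : T X) (φ : OSForm Λ.Mod V) : Prop :=
  ∀ a ∈ φ, t ∈ Λ.lift a.1 (τ a.2)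

/-- `(X, τ, t)` is a one-step wsi model of `φ`. The relation `x S y` is
`{p | x ∈ τ p} ⊆ {p | y ∈ θ p}`. -/
def IsOSWsi {V X : Type} (τ : V → Set X) (t : T X) (φ : OSForm Λ.Mod V) : Prop :=
  Λ.OSSat τ t φ ∧
  ∀ (Y : Type) (θ : V → Set Y) (s : T Y), Λ.OSSat θ s φ →
    ∀ (h : Λ.Mod) (A : Set X), t ∈ Λ.lift h A →
      s ∈ Λ.lift h (relImage (fun x y => ∀ p, x ∈ τ p → y ∈ θ p) A)

/-! ### Linear, bounded and polynomial one-step wsi models -/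

/-- The fragment `L` admits linear one-step wsi models: every relevant one-step formula
`⋀ i, ♥ᵢ aᵢ` has a one-step wsi model `(X, τ, t)` with `|τ(aᵢ)| ≤ 1` for all `i`. -/
def AdmitsLinear (sh : Bool) (L : Set (Form Λ.Mod)) : Prop :=
  ∀ B, Relevant L B → ∃ (X : Type) (τ : Var Λ.Mod → Set X) (t : T X),
    Λ.IsOSWsi τ t (starConj sh B) ∧ ∀ a ∈ (starConj sh B).vars, (τ a).encard ≤ 1

/-- The fragment `L` admits `k`-bounded one-step wsi models: every relevant one-step formula
has a one-step wsi model in which each state satisfies at most `k` of its variables. -/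
def AdmitsBounded (sh : Bool) (k : ℕ) (L : Set (Form Λ.Mod)) : Prop :=
  ∀ B, Relevant L B → ∃ (X : Type) (τ : Var Λ.Mod → Set X) (t : T X),
    Λ.IsOSWsi τ t (starConj sh B) ∧
      ∀ x, {a | a ∈ (starConj sh B).vars ∧ x ∈ τ a}.encard ≤ (k : ℕ∞)

/-- The size of a one-step formula. -/
def osSize {V : Type} (φ : OSForm Λ.Mod V) : ℕ :=
  (φ.map fun a => 1 + (Λ.code a.1).size).sum

/-- `Λ` admits polynomial one-step wsi models: every conjunctive one-step formula `φ`, over any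
set of variables, has a one-step wsi model with polynomially (in the size of `φ`) many states. -/
def AdmitsPolynomial : Prop :=
  ∃ p : Polynomial ℕ, ∀ (V : Type) (φ : OSForm Λ.Mod V),
    ∃ (X : Type) (τ : V → Set X) (t : T X),
      Λ.IsOSWsi τ t φ ∧ Finite X ∧ Nat.card X ≤ p.eval (Λ.osSize φ)

/-! ### Explicit presentations of one-step models -/

/-- The list `xs` presents the part `(X, τ)` of a one-step wsi model `(X, τ, t)` of `φ`, whose
states are the positions of `xs`, the entry at a position being the set of variables (of `φ`)
satisfied there; different states satisfy different sets of variables. -/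
def PresentsOSWsi {V : Type} (φ : OSForm Λ.Mod V) (xs : List (List V)) : Prop :=
  (∀ b ∈ xs, b.Nodup ∧ ∀ a ∈ b, a ∈ φ.vars) ∧
  (∀ i j : Fin xs.length, (∀ a, a ∈ xs.get i ↔ a ∈ xs.get j) → i = j) ∧
  ∃ t : T (Fin xs.length), Λ.IsOSWsi (fun a => {i | a ∈ xs.get i}) t φ

/-- Linearity of the presented model. -/
def LinearPres (φ : OSForm Λ.Mod (Var Λ.Mod)) (xs : List (List (Var Λ.Mod))) : Prop :=
  ∀ a ∈ φ.vars, ∀ i j : Fin xs.length, a ∈ xs.get i → a ∈ xs.get j → i = j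

/-- The presented model has at most `p(|φ|)` states. -/
def PolyPres (p : Polynomial ℕ) (φ : OSForm Λ.Mod (Var Λ.Mod))
    (xs : List (List (Var Λ.Mod))) : Prop :=
  xs.length ≤ p.eval (Λ.osSize φ)

/-- Encoding of formulas. -/
def encForm : Form Λ.Mod → Dat
  | .top => .nil
  | .and φ ψ => .cons .nil (.cons (encForm φ) (encForm ψ))
  | .mod h φ => .cons (.cons .nil .nil) (.cons (Λ.code h) (encForm φ))

/-- Encoding of variables. -/
def encVar : Var Λ.Mod → Dat
  | (none, χ) => .cons .nil (Λ.encForm χ)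
  | (some h, χ) => .cons (.cons .nil (Λ.code h)) (Λ.encForm χ)

/-- Encoding of one-step formulas. -/
def encOS (φ : OSForm Λ.Mod (Var Λ.Mod)) : Dat := encList (encPair Λ.code Λ.encVar) φ

/-- Encoding of presentations. -/
def encPres (xs : List (List (Var Λ.Mod))) : Dat := encList (encList Λ.encVar) xs

/-- `O` is a subroutine that returns, for each one-step formula relevant for `L`, a presentation
of a one-step wsi model with property `Q`. -/
def ProvidesOSWsi (sh : Bool) (O : Dat → Dat) (L : Set (Form Λ.Mod))
    (Q : OSForm Λ.Mod (Var Λ.Mod) → List (List (Var Λ.Mod)) → Prop) : Prop :=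
  ∀ B, Relevant L B → ∃ xs, O (Λ.encOS (starConj sh B)) = Λ.encPres xs ∧
    Λ.PresentsOSWsi (starConj sh B) xs ∧ Q (starConj sh B) xs

/-- Presentations of one-step wsi models with property `Q`, for the one-step formulas relevant
for `L`, can be computed in polynomial time (without oracle). -/
def OSWsiInPolyTime (sh : Bool) (L : Set (Form Λ.Mod))
    (Q : OSForm Λ.Mod (Var Λ.Mod) → List (List (Var Λ.Mod)) → Prop) : Prop :=
  SolvesInPolyTime noOracle {x | ∃ B, Relevant L B ∧ x = Λ.encOS (starConj sh B)}
    (fun x v => ∀ B, Relevant L B → x = Λ.encOS (starConj sh B) →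
      ∃ xs, v = Λ.encPres xs ∧ Λ.PresentsOSWsi (starConj sh B) xs ∧ Q (starConj sh B) xs)

end ModalStructure

/-! ### Abstract wsi models -/

/-- A state of an abstract model: its name, the one-step formula `ψ*` stored at the state, and
the one-step structure `(X, τ)` stored at it: `X` is given by the list of the names of its
elements (which are states of the model again), each together with the variables it satisfies. -/
structure AbsNode (Mod : Type) where
  name : Dat
  form : OSForm Mod (Var Mod)
  succ : List (Dat × List (Var Mod))

/-- Abstract models. -/
structure AbsModel (Mod : Type) where
  root : Dat
  nodes : List (AbsNode Mod)

/-- The states of an abstract model. -/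
def AbsModel.State {Mod : Type} (𝔄 : AbsModel Mod) : Type :=
  {s : Dat // ∃ n ∈ 𝔄.nodes, n.name = s}

/-- The set `X` stored at `n`, as a set of states. -/
def AbsModel.Succ {Mod : Type} (𝔄 : AbsModel Mod) (n : AbsNode Mod) : Type :=
  {s : 𝔄.State // ∃ e ∈ n.succ, e.1 = s.1}

/-- The valuation `τ` stored at `n`. -/
def AbsModel.val {Mod : Type} (𝔄 : AbsModel Mod) (n : AbsNode Mod) (a : Var Mod) :
    Set (𝔄.Succ n) :=
  {s | ∃ e ∈ n.succ, e.1 = s.1.1 ∧ a ∈ e.2}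

/-- `𝔄` is an abstract wsi model of `φ`: the names are used consistently; the root stores `φ*`;
an element `x` of the set `X` stored at a state stores the one-step formula of the conjunction
of the formulas substituted for the variables `a` with `x ∈ τ(a)`; and the stored structures `(X, τ)` can be completed by
`t ∈ T X` to one-step wsi models of the stored one-step formulas, in such a way that the coalgebra
with these `t` as transitions, pointed at the root, is a wsi model of `φ`. -/
def ModalStructure.IsAbstractWsi (sh : Bool) (𝔄 : AbsModel Λ.Mod) (φ : Form Λ.Mod) : Prop :=
  (𝔄.nodes.map AbsNode.name).Nodup ∧
  (∀ n ∈ 𝔄.nodes, (n.succ.map Prod.fst).Nodup ∧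
    ∀ e ∈ n.succ, (∀ a ∈ e.2, a ∈ n.form.vars) ∧
      ∃ m ∈ 𝔄.nodes, m.name = e.1 ∧ ∀ q, q ∈ m.form ↔ q ∈ starConj sh (e.2.map Prod.snd)) ∧
  ∃ (ξ : 𝔄.State → T 𝔄.State) (r : 𝔄.State),
    r.1 = 𝔄.root ∧
    (∀ n ∈ 𝔄.nodes, n.name = 𝔄.root → ∀ q, q ∈ n.form ↔ q ∈ φ.star sh) ∧
    (∀ (n : AbsNode Λ.Mod) (hn : n ∈ 𝔄.nodes), ∃ t : T (𝔄.Succ n),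
      ξ ⟨n.name, n, hn, rfl⟩ = (fun s : 𝔄.Succ n => s.1) <$> t ∧
      Λ.IsOSWsi (𝔄.val n) t n.form) ∧
    Λ.IsWsi ξ r φ

namespace ModalStructure

/-- Encoding of states of abstract models. -/
def encNode (n : AbsNode Λ.Mod) : Dat :=
  .cons n.name (.cons (Λ.encOS n.form) (encList (encPair id (encList Λ.encVar)) n.succ))

/-- Encoding of abstract models. -/
def encAbs (𝔄 : AbsModel Λ.Mod) : Dat := .cons 𝔄.root (encList Λ.encNode 𝔄.nodes)

/-- Abstract wsi models of the formulas in `L` can be computed in polynomial time,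
with `O` as a subroutine. -/
def AdmitsPolyWsiRel (sh : Bool) (O : Dat → Dat) (L : Set (Form Λ.Mod)) : Prop :=
  SolvesInPolyTime O (Λ.encForm '' L)
    (fun x v => ∀ φ ∈ L, x = Λ.encForm φ → ∃ 𝔄, v = Λ.encAbs 𝔄 ∧ Λ.IsAbstractWsi sh 𝔄 φ)

/-- The fragment `L` admits polynomial wsi models. -/
def AdmitsPolyWsi (sh : Bool) (L : Set (Form Λ.Mod)) : Prop :=
  Λ.AdmitsPolyWsiRel sh noOracle L

/-- The fragment of the conjunctive formulas of modal depth at most `d`. -/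
def depthFragment (d : ℕ) : Set (Form Λ.Mod) := {φ | φ.depth ≤ d}

end ModalStructure

end CoalgLogic

/-!
A conjunctive formula `φ` has an abstract wsi model whose states are lists `vs` of variables: the
state `vs` stores the one-step formula of the conjunction of the formulas substituted for `vs`, the
root is a single variable standing for `φ`, and the successors of `vs` are the states of a one-step
wsi model of the stored formula, each of them named by the variables it satisfies. Relating a state
`vs` to all points that satisfy its conjunction gives a simulation because the one-step models are
one-step wsi models, and the root satisfies `φ` by induction on formulas
(`isWsi_of_labelling`, `isAbstractWsi_of_closed`). Modal depth decreases along transitions, so every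
state is reached in at most `depth φ + 1` steps (`reach_closed`), and the model can be
computed in polynomial time from a polynomial-time one-step procedure as soon as the states
reachable from the root lie in a set of polynomial size (`admitsPolyWsiRel_of_procedure`).

Such a set exists in each case. For linear one-step models, the answers of the procedure
distribute the variables of a formula over the successors, so the total weight of the levels of the
tree unravelling does not increase (`admitsPolyWsiRel_of_linear`). If the size of the answers
is polynomial and the modal depth is at most `d`, then a level has at most `q ^ d` states, `q` being
polynomial (`admitsPolyWsiRel_of_polynomial`). If there are `k`-bounded one-step wsi models,
then the sets of at most `k` variables form one, since one-step wsi models can be mapped forward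
along functions that preserve and reflect the variables (`IsOSWsi.map`); this model is computable
without any knowledge of the modalities, and all states except the root are lists of length at most
`k` over the linearly many variables of `φ` (`AdmitsBounded.admitsPolyWsi`).

Programs are not written down as a whole. Instead, `PolyTime O x y` says that some program maps
every member of the family `x` of inputs to the corresponding member of `y` in polynomial time, and
this relation is closed under composition, pairing, case distinction, oracle calls and while loops
with polynomially bounded values (`PolyTime.loop`), hence under the usual operations on lists.
-/

namespace CoalgLogic

/-! ### Polynomial bounds -/

/-- `f` is bounded by a polynomial in `g`, uniformly over the index type. -/
def PolyBdd {ι : Type} (f g : ι → ℕ) : Prop :=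
  ∃ p : Polynomial ℕ, ∀ i, f i ≤ p.eval (g i)

theorem polynomial_eval_mono (p : Polynomial ℕ) {a b : ℕ} (h : a ≤ b) : p.eval a ≤ p.eval b := by
  induction p using Polynomial.induction_on' with
  | add p q hp hq => simpa using Nat.add_le_add hp hq
  | monomial n c => simpa using Nat.mul_le_mul_left c (Nat.pow_le_pow_left h n)

namespace PolyBdd

variable {ι κ : Type} {f f' g g' : ι → ℕ}

theorem refl (g : ι → ℕ) : PolyBdd g g := ⟨Polynomial.X, fun i => by simp⟩

theorem const (n : ℕ) (g : ι → ℕ) : PolyBdd (fun _ => n) g :=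
  ⟨Polynomial.C n, fun i => by simp⟩

theorem mono (h : PolyBdd f g) (hf : ∀ i, f' i ≤ f i) : PolyBdd f' g := by
  obtain ⟨p, hp⟩ := h
  exact ⟨p, fun i => (hf i).trans (hp i)⟩

theorem trans (h : PolyBdd f f') (h' : PolyBdd f' g) : PolyBdd f g := by
  obtain ⟨p, hp⟩ := h
  obtain ⟨q, hq⟩ := h'
  exact ⟨p.comp q, fun i => by
    rw [Polynomial.eval_comp]; exact (hp i).trans (polynomial_eval_mono p (hq i))⟩

theorem add (h : PolyBdd f g) (h' : PolyBdd f' g) : PolyBdd (fun i => f i + f' i) g := by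
  obtain ⟨p, hp⟩ := h
  obtain ⟨q, hq⟩ := h'
  exact ⟨p + q, fun i => by
    rw [Polynomial.eval_add]; exact Nat.add_le_add (hp i) (hq i)⟩

theorem mul (h : PolyBdd f g) (h' : PolyBdd f' g) : PolyBdd (fun i => f i * f' i) g := by
  obtain ⟨p, hp⟩ := h
  obtain ⟨q, hq⟩ := h'
  exact ⟨p * q, fun i => by
    rw [Polynomial.eval_mul]; exact Nat.mul_le_mul (hp i) (hq i)⟩

theorem pow (h : PolyBdd f g) (n : ℕ) : PolyBdd (fun i => f i ^ n) g := by
  obtain ⟨p, hp⟩ := h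
  exact ⟨p ^ n, fun i => by
    rw [Polynomial.eval_pow]; exact Nat.pow_le_pow_left (hp i) n⟩

theorem reindex (h : PolyBdd f g) (r : κ → ι) : PolyBdd (fun k => f (r k)) fun k => g (r k) := by
  obtain ⟨p, hp⟩ := h
  exact ⟨p, fun k => hp (r k)⟩

end PolyBdd

/-! ### Evaluation of programs -/

theorem Dat.one_le_size (a : Dat) : 1 ≤ a.size := by
  cases a <;> simp only [Dat.size] <;> omega

/-- The expression `e` with the indices of called functions increased by `s`. -/
def Expr.shift (s : ℕ) : Expr → Expr
  | .var i => .var i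
  | .nil => .nil
  | .cons a b => .cons (a.shift s) (b.shift s)
  | .letE a b => .letE (a.shift s) (b.shift s)
  | .matchE e n k => .matchE (e.shift s) (n.shift s) (k.shift s)
  | .ifEq a b c d => .ifEq (a.shift s) (b.shift s) (c.shift s) (d.shift s)
  | .call f e => .call (f + s) (e.shift s)
  | .ask e => .ask (e.shift s)

section Eval

variable {O : Dat → Dat} {P Q : Program} {env : List Dat} {e : Expr} {v : Dat} {c : ℕ}

/-- The cost of an evaluation bounds the size of its value. -/
theorem Eval.size_le (h : Eval O P env e v c) : v.size ≤ c := by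
  induction h <;> (try simp only [Dat.size] at *) <;> omega

theorem Eval.weaken (h : Eval O P env e v c) (env' : List Dat) :
    Eval O P (env ++ env') e v c := by
  induction h with
  | var h => exact .var (by
      rw [List.getElem?_append_left (List.getElem?_eq_some_iff.1 h).1]; exact h)
  | nil => exact .nil
  | cons _ _ ih1 ih2 => exact .cons ih1 ih2
  | letE _ _ ih1 ih2 => exact .letE ih1 ih2
  | matchNil _ _ ih1 ih2 => exact .matchNil ih1 ih2
  | matchCons _ _ ih1 ih2 => exact .matchCons ih1 ih2
  | ifEq _ _ _ ih1 ih2 ih3 => exact .ifEq ih1 ih2 ih3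
  | ifNe _ _ hne _ ih1 ih2 ih3 => exact .ifNe ih1 ih2 hne ih3
  | call _ hf hb ih1 _ => exact .call ih1 hf hb
  | ask _ ih => exact .ask ih

theorem Eval.shift (h : Eval O P env e v c) (s : ℕ)
    (hPQ : ∀ f b, P[f]? = some b → Q[f + s]? = some (b.shift s)) :
    Eval O Q env (e.shift s) v c := by
  induction h with
  | var h => exact .var h
  | nil => exact .nil
  | cons _ _ ih1 ih2 => exact .cons ih1 ih2
  | letE _ _ ih1 ih2 => exact .letE ih1 ih2
  | matchNil _ _ ih1 ih2 => exact .matchNil ih1 ih2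
  | matchCons _ _ ih1 ih2 => exact .matchCons ih1 ih2
  | ifEq _ _ _ ih1 ih2 ih3 => exact .ifEq ih1 ih2 ih3
  | ifNe _ _ hne _ ih1 ih2 ih3 => exact .ifNe ih1 ih2 hne ih3
  | call _ hf _ ih1 ih2 => exact .call ih1 (hPQ _ _ hf) ih2
  | ask _ ih => exact .ask ih

/-- A program may be preceded by other functions if its calls are renumbered accordingly. -/
theorem Eval.prepend (h : Eval O P env e v c) (Q : Program) :
    Eval O (Q ++ P.map (Expr.shift Q.length)) env (e.shift Q.length) v c :=
  h.shift _ fun f b hf => by simp [List.getElem?_append_right, hf]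

theorem Eval.append (h : Eval O P env e v c) (Q : Program) : Eval O (P ++ Q) env e v c := by
  induction h with
  | var h => exact .var h
  | nil => exact .nil
  | cons _ _ ih1 ih2 => exact .cons ih1 ih2
  | letE _ _ ih1 ih2 => exact .letE ih1 ih2
  | matchNil _ _ ih1 ih2 => exact .matchNil ih1 ih2
  | matchCons _ _ ih1 ih2 => exact .matchCons ih1 ih2
  | ifEq _ _ _ ih1 ih2 ih3 => exact .ifEq ih1 ih2 ih3
  | ifNe _ _ hne _ ih1 ih2 ih3 => exact .ifNe ih1 ih2 hne ih3
  | call _ hf _ ih1 ih2 =>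
    exact .call ih1 (by
      rw [List.getElem?_append_left (List.getElem?_eq_some_iff.1 hf).1]; exact hf) ih2
  | ask _ ih => exact .ask ih

end Eval

/-! ### Polynomial-time computable families -/

/-- The family of inputs `x i` is mapped to the family of outputs `y i` by one program in
polynomial time. Working with families, rather than with functions on all of `Dat`, allows inputs
to be restricted to those on which, for example, the oracle is known to answer correctly. -/
def PolyTime (O : Dat → Dat) {ι : Type} (x y : ι → Dat) : Prop :=
  ∃ (P : Program) (e : Expr) (c : ι → ℕ),
    (∀ i, Eval O P [x i] e (y i) (c i)) ∧ PolyBdd c fun i => (x i).size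

/-- First component of a tree. -/
def Dat.fst : Dat → Dat
  | .nil => .nil
  | .cons a _ => a

/-- Second component of a tree. -/
def Dat.snd : Dat → Dat
  | .nil => .nil
  | .cons _ b => b

namespace PolyTime

variable {O : Dat → Dat} {ι κ : Type} {x y z : ι → Dat}

theorem size_bdd (h : PolyTime O x y) : PolyBdd (fun i => (y i).size) fun i => (x i).size := by
  obtain ⟨P, e, c, hc, hb⟩ := h
  exact hb.mono fun i => (hc i).size_le

theorem reindex (h : PolyTime O x y) (r : κ → ι) :
    PolyTime O (fun k => x (r k)) fun k => y (r k) := by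
  obtain ⟨P, e, c, hc, hb⟩ := h
  exact ⟨P, e, fun k => c (r k), fun k => hc (r k), hb.reindex r⟩

theorem congr {x' y' : ι → Dat} (h : PolyTime O x y) (hx : ∀ i, x i = x' i)
    (hy : ∀ i, y i = y' i) : PolyTime O x' y' := by
  rwa [← funext hx, ← funext hy]

/-- Two programs can be merged into one. -/
theorem merge {x' y' : κ → Dat} (h : PolyTime O x y) (h' : PolyTime O x' y') :
    ∃ (P : Program) (e e' : Expr) (c : ι → ℕ) (c' : κ → ℕ),
      (∀ i, Eval O P [x i] e (y i) (c i)) ∧ (PolyBdd c fun i => (x i).size) ∧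
      (∀ i, Eval O P [x' i] e' (y' i) (c' i)) ∧ PolyBdd c' fun i => (x' i).size := by
  obtain ⟨P, e, c, hc, hb⟩ := h
  obtain ⟨P', e', c', hc', hb'⟩ := h'
  exact ⟨P ++ P'.map (Expr.shift P.length), e, e'.shift P.length, c, c',
    fun i => (hc i).append _, hb, fun i => (hc' i).prepend _, hb'⟩

theorem id : PolyTime O x x :=
  ⟨[], .var 0, fun i => 1 + (x i).size, fun _ => .var rfl, (PolyBdd.const 1 _).add (.refl _)⟩

theorem nil : PolyTime O x fun _ => .nil :=
  ⟨[], .nil, fun _ => 1, fun _ => .nil, .const 1 _⟩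

theorem comp (h : PolyTime O x y) (h' : PolyTime O y z) : PolyTime O x z := by
  have hs := h.size_bdd
  obtain ⟨P, e, e', c, c', hc, hb, hc', hb'⟩ := h.merge h'
  exact ⟨P, .letE e e', fun i => 1 + c i + c' i, fun i => .letE (hc i) ((hc' i).weaken _),
    ((PolyBdd.const 1 _).add hb).add (hb'.trans hs)⟩

theorem cons (h : PolyTime O x y) (h' : PolyTime O x z) :
    PolyTime O x fun i => .cons (y i) (z i) := by
  obtain ⟨P, e, e', c, c', hc, hb, hc', hb'⟩ := h.merge h'
  exact ⟨P, .cons e e', fun i => 1 + c i + c' i, fun i => .cons (hc i) (hc' i),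
    ((PolyBdd.const 1 _).add hb).add hb'⟩

theorem fst (h : PolyTime O x y) : PolyTime O x fun i => (y i).fst := by
  refine h.comp (z := fun i => (y i).fst) ?_
  have : ∀ a : Dat, ∃ c, Eval O [] [a] (.matchE (.var 0) .nil (.var 0)) a.fst c ∧
      c ≤ 5 + 2 * a.size := by
    rintro (_ | ⟨a, b⟩)
    · exact ⟨_, .matchNil (.var rfl) .nil, by simp [Dat.size]⟩
    · exact ⟨_, .matchCons (.var rfl) (.var rfl), by simp only [Dat.size, Dat.fst]; omega⟩
  choose c hc hb using this
  exact ⟨[], _, fun i => c (y i), fun i => hc _,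
    ((PolyBdd.const 5 _).add ((PolyBdd.const 2 _).mul (.refl _))).mono fun i => hb _⟩

theorem snd (h : PolyTime O x y) : PolyTime O x fun i => (y i).snd := by
  refine h.comp (z := fun i => (y i).snd) ?_
  have : ∀ a : Dat, ∃ c, Eval O [] [a] (.matchE (.var 0) .nil (.var 1)) a.snd c ∧
      c ≤ 5 + 2 * a.size := by
    rintro (_ | ⟨a, b⟩)
    · exact ⟨_, .matchNil (.var rfl) .nil, by simp [Dat.size]⟩
    · exact ⟨_, .matchCons (.var rfl) (.var rfl), by simp only [Dat.size, Dat.snd]; omega⟩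
  choose c hc hb using this
  exact ⟨[], _, fun i => c (y i), fun i => hc _,
    ((PolyBdd.const 5 _).add ((PolyBdd.const 2 _).mul (.refl _))).mono fun i => hb _⟩

theorem of_fst (h : PolyTime O x y) (z : ι → Dat) : PolyTime O (fun i => .cons (x i) (z i)) y :=
  (id (x := fun i => .cons (x i) (z i))).fst.comp h

open Classical in
theorem ite_eq {a b : ι → Dat} (ha : PolyTime O x a) (hb : PolyTime O x b)
    (hy : PolyTime O x y) (hz : PolyTime O x z) :
    PolyTime O x fun i => if a i = b i then y i else z i := by
  -- all four results are computed beforehand, so that only variables remain to be compared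
  have h := (ha.cons hb).cons (hy.cons hz)
  refine h.comp ?_
  have key : ∀ a b y z : Dat, ∃ c, Eval O [] [.cons (.cons a b) (.cons y z)]
      (.matchE (.var 0) .nil (.matchE (.var 0) .nil (.matchE (.var 3) .nil
        (.ifEq (.var 2) (.var 3) (.var 0) (.var 1))))) (if a = b then y else z) c ∧
      c ≤ 20 + 5 * (Dat.cons (.cons a b) (.cons y z)).size := by
    intro a b y z
    split_ifs with h
    · subst h
      exact ⟨_, .matchCons (.var rfl) (.matchCons (.var rfl) (.matchCons (.var rfl)
        (.ifEq (.var rfl) (.var rfl) (.var rfl)))), by simp only [Dat.size]; omega⟩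
    · exact ⟨_, .matchCons (.var rfl) (.matchCons (.var rfl) (.matchCons (.var rfl)
        (.ifNe (.var rfl) (.var rfl) h (.var rfl)))), by simp only [Dat.size]; omega⟩
  choose c hc hb using key
  exact ⟨[], _, fun i => c (a i) (b i) (y i) (z i), fun i => hc _ _ _ _,
    ((PolyBdd.const 20 _).add ((PolyBdd.const 5 _).mul (.refl _))).mono fun i => hb _ _ _ _⟩

/-- An oracle call takes polynomial time if its answer has polynomial size. -/
theorem ask (h : PolyTime O x y)
    (hb : PolyBdd (fun i => (O (y i)).size) fun i => (y i).size) :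
    PolyTime O x fun i => O (y i) := by
  refine h.comp (z := fun i => O (y i)) ?_
  exact ⟨[], .ask (.var 0), fun i => 1 + (1 + (y i).size) + (O (y i)).size,
    fun i => .ask (.var rfl),
    ((PolyBdd.const 1 _).add ((PolyBdd.const 1 _).add (.refl _))).add hb⟩

/-- A while loop: as long as `t` is not `nil`, the pair `(t, s)` is replaced by its successor.
The number of iterations and the size of all intermediate values have to be polynomially
bounded. -/
theorem loop {n : ι → ℕ} {t s : ι → ℕ → Dat}
    (h0 : PolyTime O x fun i => .cons (t i 0) (s i 0))
    (hstep : PolyTime O (fun k : Σ i, Fin (n i) => .cons (t k.1 k.2) (s k.1 k.2))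
      fun k => .cons (t k.1 (k.2 + 1)) (s k.1 (k.2 + 1)))
    (ht : ∀ i, ∀ j < n i, t i j ≠ .nil) (hn : ∀ i, t i (n i) = .nil)
    (hnb : PolyBdd n fun i => (x i).size) {m : ι → ℕ} (hm : PolyBdd m fun i => (x i).size)
    (hb : ∀ i, ∀ j ≤ n i, (t i j).size + (s i j).size ≤ m i) :
    PolyTime O x fun i => s i (n i) := by
  obtain ⟨P, e0, e, c0, c, hc0, hb0, hc, p, hp⟩ := h0.merge hstep
  -- a new recursive function: its argument is `(t, s)`, and `e` computes the next such pair
  let body : Expr := .matchE (.var 0) .nil (.matchE (.var 0) (.var 1)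
    (.call P.length (.letE (.var 4) e)))
  have hbody : (P ++ [body])[P.length]? = some body := by simp
  -- bound for the cost of one iteration, including the copying of variables
  let K : ι → ℕ := fun i => 10 + 3 * m i + p.eval (1 + m i)
  have run : ∀ i, ∀ d j, j + d = n i → ∃ c,
      Eval O (P ++ [body]) [.cons (t i j) (s i j)] body (s i (n i)) c ∧ c ≤ (d + 1) * K i := by
    intro i d
    induction d with
    | zero =>
      intro j hj
      obtain rfl : j = n i := by omega
      have hv : Eval O (P ++ [body])
          [t i (n i), s i (n i), .cons (t i (n i)) (s i (n i))] (.var 0) .nil 2 := by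
        rw [hn]; exact .var rfl
      refine ⟨_, .matchCons (.var rfl) (.matchNil hv (.var rfl)), ?_⟩
      have := hb i (n i) le_rfl
      simp only [Dat.size, K]; omega
    | succ d ih =>
      intro j hj
      obtain ⟨c', hc', hle⟩ := ih (j + 1) (by omega)
      have hbj := hb i j (by omega)
      have hpj := hp ⟨i, j, by omega⟩
      have hcj := hc ⟨i, j, by omega⟩
      simp only at hpj hcj
      generalize c ⟨i, j, _⟩ = cj at hpj hcj
      have hpj := hpj.trans (polynomial_eval_mono p (b := 1 + m i) (by simp only [Dat.size]; omega))
      have hne := ht i j (by omega)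
      rcases htj : t i j with _ | ⟨a, b⟩
      · exact absurd htj hne
      rw [htj] at hcj hbj
      refine ⟨_, .matchCons (.var rfl) (.matchCons (.var rfl) (.call
        (.letE (.var rfl) ((hcj.append _).weaken _)) hbody hc')), ?_⟩
      have : (d + 1 + 1) * K i = (d + 1) * K i + K i := by ring
      rw [this]
      simp only [Dat.size] at hbj ⊢
      have : K i = 10 + 3 * m i + p.eval (1 + m i) := rfl
      omega
  choose c' hc' hle using fun i => run i (n i) 0 (by omega)
  refine ⟨P ++ [body], .call P.length e0, fun i => 1 + c0 i + c' i,
    fun i => .call ((hc0 i).append _) hbody (hc' i), ?_⟩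
  have hK : PolyBdd K fun i => (x i).size :=
    ((PolyBdd.const 10 _).add ((PolyBdd.const 3 _).mul hm)).add
      (PolyBdd.trans (f' := fun i => 1 + m i) ⟨p, fun i => le_rfl⟩ ((PolyBdd.const 1 _).add hm))
  exact ((PolyBdd.const 1 _).add hb0).add (((hnb.add (.const 1 _)).mul hK).mono hle)

/-- Families computable in polynomial time give programs in the sense of `SolvesInPolyTime`. -/
theorem solves {D : Set Dat} {R : Dat → Dat → Prop} (h : PolyTime O x y)
    (hD : ∀ d ∈ D, ∃ i, x i = d ∧ R d (y i)) : SolvesInPolyTime O D R := by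
  obtain ⟨P, e, c, hc, p, hp⟩ := h
  refine ⟨[e.shift 1] ++ P.map (Expr.shift 1), 2 + Polynomial.X + p, fun d hd => ?_⟩
  obtain ⟨i, rfl, hR⟩ := hD d hd
  refine ⟨y i, _, .call (.var rfl) rfl ((hc i).shift 1 fun f b hf => by simp [hf]), ?_, hR⟩
  have : c i ≤ p.eval (x i).size := hp i
  simp only [Polynomial.eval_add, Polynomial.eval_X, Polynomial.eval_ofNat]
  omega

end PolyTime

/-! ### Polynomial-time operations on lists -/

theorem size_encList {α : Type} (e : α → Dat) (l : List α) :
    (encList e l).size = 1 + (l.map fun a => 1 + (e a).size).sum := by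
  induction l with
  | nil => simp [encList, Dat.size]
  | cons a l ih => simp only [encList, Dat.size, ih, List.map_cons, List.sum_cons]; omega

theorem encList_injective {α : Type} {e : α → Dat} (he : Function.Injective e) :
    Function.Injective (encList e) := by
  intro l
  induction l with
  | nil => rintro (_ | ⟨b, l'⟩) h <;> simp_all [encList]
  | cons a l ih =>
    rintro (_ | ⟨b, l'⟩) h
    · simp [encList] at h
    · simp only [encList, Dat.cons.injEq] at h
      rw [he h.1, ih h.2]

theorem size_le_encList {α : Type} (e : α → Dat) {l : List α} {a : α} (ha : a ∈ l) :
    (e a).size ≤ (encList e l).size := by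
  have := List.single_le_sum (by simp) _ (List.mem_map_of_mem (f := fun a => 1 + (e a).size) ha)
  rw [size_encList]; omega

theorem length_le_encList {α : Type} (e : α → Dat) (l : List α) :
    l.length ≤ (encList e l).size := by
  induction l with
  | nil => simp
  | cons a l ih => simp only [encList, Dat.size, List.length_cons]; omega

theorem encList_le_of_suffix {α : Type} (e : α → Dat) {l l' : List α} (h : l <:+ l') :
    (encList e l).size ≤ (encList e l').size := by
  obtain ⟨s, rfl⟩ := h
  simp only [size_encList, List.map_append, List.sum_append]; omega

theorem encList_le_of_forall {α : Type} (e : α → Dat) {l : List α} {m : ℕ}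
    (h : ∀ a ∈ l, (e a).size ≤ m) : (encList e l).size ≤ 1 + l.length * (1 + m) := by
  rw [size_encList]
  have := List.sum_le_card_nsmul (l.map fun a => 1 + (e a).size) (1 + m) (by
    simp only [List.mem_map, forall_exists_index, and_imp, forall_apply_eq_imp_iff₂]
    exact fun a ha => by have := h a ha; omega)
  simp only [List.length_map, smul_eq_mul] at this
  omega

open Classical in
/-- Union of lists of members of an arbitrary type: duplicates-free if the second list is. -/
noncomputable def listUnion {α : Type} (l l' : List α) : List α := l ∪ l'

theorem mem_listUnion {α : Type} {l l' : List α} {a : α} :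
    a ∈ listUnion l l' ↔ a ∈ l ∨ a ∈ l' := by
  classical
  exact List.mem_union_iff

theorem nodup_listUnion {α : Type} (l : List α) {l' : List α} (h : l'.Nodup) :
    (listUnion l l').Nodup := by
  classical
  exact h.union l

open Classical in
/-- The members of `l` that belong to `l'`, in the order of `l`. -/
noncomputable def listInter {α : Type} (l l' : List α) : List α := l.filter (· ∈ l')

theorem mem_listInter {α : Type} {l l' : List α} {a : α} :
    a ∈ listInter l l' ↔ a ∈ l ∧ a ∈ l' := by
  simp [listInter]

theorem nodup_listInter {α : Type} {l : List α} (h : l.Nodup) (l' : List α) :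
    (listInter l l').Nodup := h.filter _

namespace PolyTime

variable {O : Dat → Dat} {ι : Type} {x : ι → Dat} {α β : Type}

/-- Iteration over a list: the value `acc i (j + 1)` is computed from the input `x i`, the entry
number `j` of the list, and `acc i j`. -/
theorem foldl (e : α → Dat) {l : ι → List α} {acc : ι → ℕ → Dat}
    (hl : PolyTime O x fun i => encList e (l i)) (h0 : PolyTime O x fun i => acc i 0)
    (hstep : PolyTime O
      (fun k : Σ i, Fin (l i).length =>
        .cons (x k.1) (.cons (e (l k.1)[k.2]) (acc k.1 k.2)))
      fun k => acc k.1 (k.2 + 1))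
    {m : ι → ℕ} (hm : PolyBdd m fun i => (x i).size)
    (hb : ∀ i, ∀ j ≤ (l i).length, (acc i j).size ≤ m i) :
    PolyTime O x fun i => acc i (l i).length := by
  refine (loop (n := fun i => (l i).length) (t := fun i j => encList e ((l i).drop j))
    (s := fun i j => .cons (x i) (acc i j)) (hl.cons (id.cons h0)) ?_ ?_ ?_ ?_
    (m := fun i => (encList e (l i)).size + (1 + (x i).size + m i)) ?_ ?_).snd
  · have hd : ∀ k : Σ i, Fin (l i).length, encList e ((l k.1).drop k.2) =
        .cons (e (l k.1)[k.2]) (encList e ((l k.1).drop (k.2 + 1))) := fun k => by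
      rw [List.drop_eq_getElem_cons k.2.2]; rfl
    simp only [hd]
    have hD := PolyTime.id (O := O) (x := fun k : Σ i, Fin (l i).length =>
      Dat.cons (.cons (e (l k.1)[k.2]) (encList e ((l k.1).drop (k.2 + 1))))
        (.cons (x k.1) (acc k.1 k.2)))
    exact hD.fst.snd.cons (hD.snd.fst.cons ((hD.snd.fst.cons (hD.fst.fst.cons hD.snd.snd)).comp
      hstep))
  · intro i j hj
    rw [List.drop_eq_getElem_cons hj]
    simp [encList]
  · simp [encList]
  · exact hl.size_bdd.mono fun i => length_le_encList _ _
  · exact hl.size_bdd.add (((PolyBdd.const 1 _).add (.refl _)).add hm)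
  · intro i j hj
    have h1 := encList_le_of_suffix e (List.drop_suffix j (l i))
    have h2 := hb i j hj
    simp only [Dat.size]; omega

theorem reverse (e : α → Dat) {l : ι → List α} (hl : PolyTime O x fun i => encList e (l i)) :
    PolyTime O x fun i => encList e (l i).reverse := by
  have := foldl e (acc := fun i j => encList e ((l i).take j).reverse) hl
    (by simpa [encList] using nil) (m := fun i => (encList e (l i)).size) ?_ hl.size_bdd ?_
  · simpa using this
  · refine (id.snd.fst.cons id.snd.snd).congr (fun _ => rfl) fun k => ?_
    rw [List.take_succ_eq_append_getElem k.2.2, List.reverse_append]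
    rfl
  · intro i j _
    have := encList_le_of_suffix e (List.reverse_suffix.2 (List.take_prefix j (l i)))
    refine this.trans (le_of_eq ?_)
    simp [size_encList, List.sum_reverse]

/-- Structural recursion on lists: if `F i (a :: l')` is computable from the input `x i`, the
entry `a` and the value `F i l'`, and the values of `F` are polynomially bounded, then `F` is
computable. -/
theorem foldr (e : α → Dat) {l : ι → List α} {F : ι → List α → Dat}
    (hl : PolyTime O x fun i => encList e (l i)) (h0 : PolyTime O x fun i => F i [])
    (hstep : PolyTime O
      (fun k : {k : ι × α × List α // k.2.1 :: k.2.2 <:+ l k.1} =>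
        .cons (x k.1.1) (.cons (e k.1.2.1) (F k.1.1 k.1.2.2)))
      fun k => F k.1.1 (k.1.2.1 :: k.1.2.2))
    {m : ι → ℕ} (hm : PolyBdd m fun i => (x i).size)
    (hb : ∀ i, ∀ l', l' <:+ l i → (F i l').size ≤ m i) :
    PolyTime O x fun i => F i (l i) := by
  have hsuf : ∀ i j, ((l i).reverse.take j).reverse <:+ l i := fun i j => by
    have := List.reverse_suffix.2 (List.take_prefix j (l i).reverse)
    rwa [List.reverse_reverse] at this
  have hc : ∀ i j, (hj : j < (l i).reverse.length) → ((l i).reverse.take (j + 1)).reverse =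
      (l i).reverse[j] :: ((l i).reverse.take j).reverse := fun i j hj => by
    rw [List.take_succ_eq_append_getElem hj, List.reverse_append]
    rfl
  have := foldl e (l := fun i => (l i).reverse)
    (acc := fun i j => F i ((l i).reverse.take j).reverse) (reverse e hl)
    (by simpa using h0) (m := m) ?_ hm fun i j _ => hb i _ (hsuf i j)
  · refine this.congr (fun _ => rfl) fun i => ?_
    rw [List.take_length, List.reverse_reverse]
  · refine (hstep.reindex fun k : Σ i, Fin (l i).reverse.length =>
      ⟨(k.1, (l k.1).reverse[k.2], ((l k.1).reverse.take k.2).reverse), ?_⟩).congr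
      (fun _ => rfl) fun k => ?_
    · have := hsuf k.1 (k.2 + 1)
      rwa [hc _ _ k.2.2] at this
    · simp only [hc _ _ k.2.2]
      rfl

theorem append (e : α → Dat) {l l' : ι → List α} (hl : PolyTime O x fun i => encList e (l i))
    (hl' : PolyTime O x fun i => encList e (l' i)) :
    PolyTime O x fun i => encList e (l i ++ l' i) := by
  refine foldr e (F := fun i s => encList e (s ++ l' i)) hl (by simpa using hl')
    (m := fun i => (encList e (l i)).size + (encList e (l' i)).size) id.snd
    (hl.size_bdd.add hl'.size_bdd) ?_
  intro i s hs
  have := encList_le_of_suffix e hs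
  simp only [size_encList, List.map_append, List.sum_append] at *
  omega

theorem flatMap (e : α → Dat) (e' : β → Dat) {l : ι → List α} {f : ι → α → List β}
    (hl : PolyTime O x fun i => encList e (l i))
    (hf : PolyTime O (fun k : {k : ι × α // k.2 ∈ l k.1} => .cons (x k.1.1) (e k.1.2))
      fun k => encList e' (f k.1.1 k.1.2)) :
    PolyTime O x fun i => encList e' ((l i).flatMap (f i)) := by
  obtain ⟨p, hp⟩ := hf.size_bdd
  let m : ι → ℕ := fun i => 1 + (encList e (l i)).size *
    p.eval (1 + (x i).size + (encList e (l i)).size)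
  have hm : PolyBdd m fun i => (x i).size :=
    (PolyBdd.const 1 _).add (hl.size_bdd.mul (PolyBdd.trans
      (f' := fun i => 1 + (x i).size + (encList e (l i)).size) ⟨p, fun _ => le_rfl⟩
      (((PolyBdd.const 1 _).add (.refl _)).add hl.size_bdd)))
  refine foldr e (F := fun i s => encList e' (s.flatMap (f i))) hl
    (by simpa [encList] using nil) (m := m) ?_ hm ?_
  · have hs : ∀ k : {k : ι × α × List α // k.2.1 :: k.2.2 <:+ l k.1}, k.1.2.1 ∈ l k.1.1 :=
      fun k => k.2.subset List.mem_cons_self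
    exact append e' ((id.fst.cons id.snd.fst).comp
      (hf.reindex fun k : {k : ι × α × List α // k.2.1 :: k.2.2 <:+ l k.1} =>
        ⟨(k.1.1, k.1.2.1), hs k⟩)) id.snd.snd
  · intro i s hs
    have key : ∀ s : List α, s ⊆ l i → (encList e' (s.flatMap (f i))).size ≤
        1 + s.length * p.eval (1 + (x i).size + (encList e (l i)).size) := by
      intro s
      induction s with
      | nil => simp [encList, Dat.size]
      | cons a s ih =>
        intro hs
        have h1 := ih fun b hb => hs (List.mem_cons_of_mem _ hb)
        have ha : a ∈ l i := hs List.mem_cons_self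
        have h2 : (encList e' (f i a)).size ≤ _ := hp ⟨(i, a), ha⟩
        have h3 := h2.trans (polynomial_eval_mono p
          (b := 1 + (x i).size + (encList e (l i)).size) (by
          have := size_le_encList e ha
          simp only [Dat.size]; omega))
        simp only [size_encList e', List.flatMap_cons, List.map_append, List.sum_append,
          List.length_cons, add_mul] at *
        omega
    refine (key s hs.subset).trans (Nat.add_le_add_left (Nat.mul_le_mul_right _ ?_) 1)
    exact hs.length_le.trans (length_le_encList e _)

theorem map (e : α → Dat) (e' : β → Dat) {l : ι → List α} {f : ι → α → β}
    (hl : PolyTime O x fun i => encList e (l i))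
    (hf : PolyTime O (fun k : {k : ι × α // k.2 ∈ l k.1} => .cons (x k.1.1) (e k.1.2))
      fun k => e' (f k.1.1 k.1.2)) :
    PolyTime O x fun i => encList e' ((l i).map (f i)) := by
  simp only [List.map_eq_flatMap]
  exact flatMap e e' hl (hf.cons nil)

open Classical in
theorem mem {e : α → Dat} (he : Function.Injective e) {l : ι → List α} {a : ι → α}
    (hl : PolyTime O x fun i => encList e (l i)) (ha : PolyTime O x fun i => e (a i)) :
    PolyTime O x fun i => if a i ∈ l i then .cons .nil .nil else .nil := by
  refine foldr e (F := fun i s => if a i ∈ s then .cons .nil .nil else .nil) hl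
    (by simpa using nil) (m := fun _ => 3) ?_ (.const 3 _) ?_
  · refine (ite_eq ((ha.reindex fun k : {k : ι × α × List α // k.2.1 :: k.2.2 <:+ l k.1} =>
      k.1.1).of_fst _) id.snd.fst (nil.cons nil) id.snd.snd).congr (fun _ => rfl) fun k => ?_
    by_cases h : a k.1.1 = k.1.2.1
    · simp [h, Dat.snd, Dat.fst]
    · simp [h, he.eq_iff, Dat.snd, Dat.fst]
  · intro i s _
    split_ifs <;> simp [Dat.size]

open Classical in
theorem insert {e : α → Dat} (he : Function.Injective e) {l : ι → List α} {a : ι → α}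
    (hl : PolyTime O x fun i => encList e (l i)) (ha : PolyTime O x fun i => e (a i)) :
    PolyTime O x fun i => encList e ((l i).insert (a i)) := by
  refine (ite_eq (mem he hl ha) nil (ha.cons hl) hl).congr (fun _ => rfl) fun i => ?_
  by_cases h : a i ∈ l i <;> simp [h, encList]

open Classical in
theorem union {e : α → Dat} (he : Function.Injective e) {l l' : ι → List α}
    (hl : PolyTime O x fun i => encList e (l i)) (hl' : PolyTime O x fun i => encList e (l' i)) :
    PolyTime O x fun i => encList e (listUnion (l i) (l' i)) := by
  refine foldr e (F := fun i s => encList e (listUnion s (l' i)))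
    hl (by simpa [listUnion] using hl')
    (m := fun i => (encList e (l i)).size + (encList e (l' i)).size) ?_
    (hl.size_bdd.add hl'.size_bdd) ?_
  · simp only [listUnion, List.cons_union]
    exact insert he id.snd.snd id.snd.fst
  · intro i s hs
    have h1 := encList_le_of_suffix e hs
    have h2 : (encList e (listUnion s (l' i))).size ≤
        (encList e s).size + (encList e (l' i)).size := by
      unfold listUnion
      clear hs h1
      induction s with
      | nil => simp
      | cons a s ih =>
        rw [List.cons_union]
        by_cases h : a ∈ s ∪ l' i
        · rw [List.insert_of_mem h]
          simp only [encList, Dat.size] at *; omega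
        · rw [List.insert_of_not_mem h]
          simp only [encList, Dat.size] at *; omega
    omega

theorem inter {e : α → Dat} (he : Function.Injective e) {l l' : ι → List α}
    (hl : PolyTime O x fun i => encList e (l i)) (hl' : PolyTime O x fun i => encList e (l' i)) :
    PolyTime O x fun i => encList e (listInter (l i) (l' i)) := by
  classical
  have : PolyTime O x fun i => encList e ((l i).flatMap fun a => if a ∈ l' i then [a] else []) := by
    refine flatMap e e hl ?_
    refine (ite_eq (mem he ((hl'.reindex fun k : {k : ι × α // k.2 ∈ l k.1} =>
      k.1.1).of_fst _) id.snd) nil nil (id.snd.cons nil)).congr (fun _ => rfl) fun k => ?_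
    by_cases h : k.1.2 ∈ l' k.1.1 <;> simp [h, encList, Dat.snd]
  refine this.congr (fun _ => rfl) fun i => ?_
  congr 1
  unfold listInter
  induction l i with
  | nil => rfl
  | cons a s ih => by_cases h : a ∈ l' i <;> simp_all

/-- One step of the traversal of a stack of trees: the top of the stack is replaced by its
immediate subtrees. The total size decreases by exactly one in every step, so that a tree serves
as a counter. -/
def popStack : List Dat → List Dat
  | [] => []
  | .nil :: l => l
  | .cons a b :: l => a :: b :: l

theorem size_popStack (l : List Dat) :
    ((popStack l).map Dat.size).sum = (l.map Dat.size).sum - 1 := by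
  rcases l with _ | ⟨_ | ⟨a, b⟩, l⟩
  · rfl
  · simp [popStack, Dat.size]
  · simp only [popStack, Dat.size, List.map_cons, List.sum_cons]; omega

/-- Iteration, as often as the size of the input says. -/
theorem iterate {acc : ι → ℕ → Dat} (h0 : PolyTime O x fun i => acc i 0)
    (hstep : PolyTime O
      (fun k : Σ i, Fin (x i).size => .cons (x k.1) (acc k.1 k.2)) fun k => acc k.1 (k.2 + 1))
    {m : ι → ℕ} (hm : PolyBdd m fun i => (x i).size)
    (hb : ∀ i, ∀ j ≤ (x i).size, (acc i j).size ≤ m i) :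
    PolyTime O x fun i => acc i (x i).size := by
  let st : ι → ℕ → List Dat := fun i j => popStack^[j] [x i]
  have hst : ∀ i j, ((st i j).map Dat.size).sum = (x i).size - j := by
    intro i j
    induction j with
    | zero => simp [st]
    | succ j ih =>
      have : st i (j + 1) = popStack (st i j) := Function.iterate_succ_apply' _ _ _
      rw [this, size_popStack, ih]; omega
  refine (loop (n := fun i => (x i).size) (t := fun i j => encList _root_.id (st i j))
    (s := fun i j => .cons (x i) (acc i j)) ((id.cons nil).cons (id.cons h0)) ?_ ?_ ?_
    (.refl _) (m := fun i => 1 + 2 * (x i).size + (1 + (x i).size + m i)) ?_ ?_).snd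
  · have hs : ∀ k : Σ i, Fin (x i).size, st k.1 (k.2 + 1) = popStack (st k.1 k.2) :=
      fun k => Function.iterate_succ_apply' _ _ _
    simp only [hs]
    refine .cons ?_ (id.snd.fst.cons (id.snd.comp hstep))
    refine (ite_eq id.fst.fst nil id.fst.snd
      (id.fst.fst.fst.cons (id.fst.fst.snd.cons id.fst.snd))).congr (fun _ => rfl) fun k => ?_
    rcases st k.1 k.2 with _ | ⟨_ | ⟨a, b⟩, l⟩ <;> simp [popStack, encList, Dat.fst, Dat.snd]
  · intro i j hj h
    have := hst i j
    rcases hs : st i j with _ | ⟨a, l⟩ <;> rw [hs] at this h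
    · simp at this; omega
    · simp [encList] at h
  · intro i
    have := hst i (x i).size
    rcases hs : st i (x i).size with _ | ⟨a, l⟩
    · simp [encList]
    · have := a.one_le_size
      simp_all
  · exact ((PolyBdd.const 1 _).add ((PolyBdd.const 2 _).mul (.refl _))).add
      (((PolyBdd.const 1 _).add (.refl _)).add hm)
  · intro i j hj
    have h1 := hb i j hj
    have h2 := hst i j
    have h3 : ∀ l : List Dat, (encList _root_.id l).size ≤ 1 + 2 * (l.map Dat.size).sum := by
      intro l
      induction l with
      | nil => simp [encList, Dat.size]
      | cons a l ih =>
        have := a.one_le_size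
        simp only [encList, Dat.size, List.map_cons, List.sum_cons, _root_.id] at *
        omega
    have h4 := h3 (st i j)
    simp only [Dat.size]; omega

end PolyTime

/-! ### Decomposition of formulas -/

section Decomposition

variable {M : Type} {sh : Bool}

theorem mem_starConj {B : List (Form M)} {q : M × Var M} :
    q ∈ starConj sh B ↔ ∃ χ ∈ B, q ∈ χ.star sh := List.mem_flatMap

theorem Form.map_vars_star (φ : Form M) : (OSForm.vars (φ.star sh)).map Prod.snd = φ.args := by
  induction φ with
  | top => rfl
  | and φ ψ ih1 ih2 => simp_all [Form.star, Form.args, OSForm.vars]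
  | mod h φ => rfl

theorem mem_vars_starConj {B : List (Form M)} {a : Var M} :
    a ∈ OSForm.vars (starConj sh B) ↔ ∃ φ ∈ B, a ∈ OSForm.vars (φ.star sh) := by
  simp only [OSForm.vars, List.mem_map, mem_starConj]
  exact ⟨fun ⟨q, ⟨φ, hφ, hq⟩, ha⟩ => ⟨φ, hφ, q, hq, ha⟩,
    fun ⟨φ, hφ, q, hq, ha⟩ => ⟨q, ⟨φ, hφ, hq⟩, ha⟩⟩

theorem Form.snd_mem_args {φ : Form M} {a : Var M} (ha : a ∈ OSForm.vars (φ.star sh)) :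
    a.2 ∈ φ.args := by
  rw [← φ.map_vars_star (sh := sh)]
  exact List.mem_map_of_mem ha

theorem Form.depth_lt_of_mem_args {φ χ : Form M} (h : χ ∈ φ.args) : χ.depth < φ.depth := by
  induction φ with
  | top => simp [Form.args] at h
  | and φ ψ ih1 ih2 =>
    rcases List.mem_append.1 h with h | h
    · exact (ih1 h).trans_le (le_max_left _ _)
    · exact (ih2 h).trans_le (le_max_right _ _)
  | mod m φ =>
    obtain rfl : χ = φ := by simpa [Form.args] using h
    exact Nat.lt_succ_self _

end Decomposition

namespace ModalStructure

variable {T : Type → Type} [Functor T] {Λ : ModalStructure T} {sh : Bool}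

/-! ### Semantics -/

/-- A one-step wsi model may be mapped forward, provided that the satisfied variables of the
formula are kept and no variables become satisfied. -/
theorem IsOSWsi.map {V X X' : Type} {τ : V → Set X} {τ' : V → Set X'} {t : T X}
    {φ : OSForm Λ.Mod V} (H : Λ.IsOSWsi τ t φ) (g : X → X')
    (h1 : ∀ x p, g x ∈ τ' p → x ∈ τ p) (h2 : ∀ a ∈ φ.vars, ∀ x ∈ τ a, g x ∈ τ' a) :
    Λ.IsOSWsi τ' (g <$> t) φ := by
  have hl : ∀ (h : Λ.Mod) (A : Set X'), g <$> t ∈ Λ.lift h A ↔ t ∈ Λ.lift h (g ⁻¹' A) :=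
    fun h A => by rw [Λ.lift_natural]; rfl
  refine ⟨fun a ha => (hl _ _).2 (Λ.lift_mono _ (h2 a.2 (List.mem_map_of_mem ha)) (H.1 a ha)),
    fun Y θ s hs h A ht => ?_⟩
  refine Λ.lift_mono h ?_ (H.2 Y θ s hs h _ ((hl _ _).1 ht))
  rintro y ⟨x, hx, hxy⟩
  exact ⟨g x, hx, fun p hp => hxy p (h1 x p hp)⟩

/-- The states of a one-step wsi model that satisfy the same variables may be identified, and
further states may be added. -/
theorem IsOSWsi.presents {V X : Type} {τ : V → Set X} {t : T X}
    {φ : OSForm Λ.Mod V} (H : Λ.IsOSWsi τ t φ) {xs : List (List V)}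
    (hxs : ∀ b ∈ xs, b.Nodup ∧ ∀ a ∈ b, a ∈ φ.vars)
    (hinj : ∀ i j : Fin xs.length, (∀ a, a ∈ xs.get i ↔ a ∈ xs.get j) → i = j)
    (hsurj : ∀ x, ∃ b ∈ xs, ∀ a ∈ φ.vars, a ∈ b ↔ x ∈ τ a) : Λ.PresentsOSWsi φ xs := by
  have : ∀ x, ∃ i : Fin xs.length, ∀ a ∈ φ.vars, a ∈ xs.get i ↔ x ∈ τ a := fun x => by
    obtain ⟨b, hb, h⟩ := hsurj x
    obtain ⟨i, rfl⟩ := List.get_of_mem hb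
    exact ⟨i, h⟩
  choose g hg using this
  exact ⟨hxs, hinj, g <$> t, H.map g
    (fun x p hp => (hg x p ((hxs _ (List.get_mem _ _)).2 p hp)).1 hp)
    fun a ha x hx => (hg x a ha).2 hx⟩

theorem sat_iff_star {X : Type} {ξ : X → T X} {φ : Form Λ.Mod} {x : X} :
    Λ.Sat ξ φ x ↔ ∀ q ∈ φ.star sh, ξ x ∈ Λ.lift q.1 {y | Λ.Sat ξ q.2.2 y} := by
  induction φ with
  | top => simp [Sat, Form.star]
  | and φ ψ ih1 ih2 =>
    simp only [Sat, Form.star, List.mem_append, ih1, ih2]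
    exact ⟨fun ⟨h1, h2⟩ q hq => hq.elim (h1 q) (h2 q),
      fun h => ⟨fun q hq => h q (.inl hq), fun q hq => h q (.inr hq)⟩⟩
  | mod h φ => simp [Sat, Form.star, mkVar]

/-- Simulations preserve conjunctive formulas. -/
theorem IsSimulation.sat {X Y : Type} {ξ : X → T X} {ζ : Y → T Y} {S : X → Y → Prop}
    (hS : Λ.IsSimulation ξ ζ S) {φ : Form Λ.Mod} {x : X} {y : Y} (h : S x y)
    (hx : Λ.Sat ξ φ x) : Λ.Sat ζ φ y := by
  induction φ generalizing x y with
  | top => trivial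
  | and φ ψ ih1 ih2 => exact ⟨ih1 h hx.1, ih2 h hx.2⟩
  | mod m φ ih =>
    refine Λ.lift_mono m ?_ (hS x y h m _ hx)
    rintro y' ⟨x', hx', h'⟩
    exact ih h' hx'

/-- One-step wsi models fit together to wsi models: if every state `x` of a coalgebra is labelled
with a conjunction `B x`, and its transition comes from a one-step wsi model of `(B x)*` whose
states are labelled with the conjunction of the formulas they have to satisfy, then a state
labelled with `φ` is a wsi model of `φ`. -/
theorem isWsi_of_labelling {X : Type} {ξ : X → T X} (B : X → List (Form Λ.Mod))
    (H : ∀ x, ∃ (Z : Type) (τ : Var Λ.Mod → Set Z) (t : T Z) (g : Z → X), ξ x = g <$> t ∧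
      Λ.IsOSWsi τ t (starConj sh (B x)) ∧ ∀ z χ, χ ∈ B (g z) ↔ ∃ p, z ∈ τ p ∧ p.2 = χ)
    {r : X} {φ : Form Λ.Mod} (hr : B r = [φ]) : Λ.IsWsi ξ r φ := by
  have hl : ∀ {Z : Type} (g : Z → X) (t : T Z) (h : Λ.Mod) (A : Set X),
      g <$> t ∈ Λ.lift h A ↔ t ∈ Λ.lift h (g ⁻¹' A) :=
    fun g t h A => by rw [Λ.lift_natural]; rfl
  have truth : ∀ (χ : Form Λ.Mod) (x : X), (∀ q ∈ χ.star sh, q ∈ starConj sh (B x)) →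
      Λ.Sat ξ χ x := by
    intro χ
    induction χ with
    | top => exact fun _ _ => trivial
    | and χ χ' ih1 ih2 =>
      exact fun x hx => ⟨ih1 x fun q hq => hx q (List.mem_append_left _ hq),
        ih2 x fun q hq => hx q (List.mem_append_right _ hq)⟩
    | mod h χ ih =>
      intro x hx
      obtain ⟨Z, τ, t, g, hξ, hw, hB⟩ := H x
      have hs := hw.1 (h, mkVar sh h χ) (hx _ (by simp [Form.star]))
      change ξ x ∈ _
      rw [hξ, hl]
      refine Λ.lift_mono h (fun z hz => ih (g z) fun q hq => ?_) hs
      exact mem_starConj.2 ⟨χ, (hB z χ).2 ⟨_, hz, rfl⟩, hq⟩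
  intro Y ζ y
  constructor
  · intro hy
    refine ⟨fun x y => ∀ χ ∈ B x, Λ.Sat ζ χ y, ?_, by simpa [hr] using hy⟩
    intro x y hxy h A hA
    obtain ⟨Z, τ, t, g, hξ, hw, hB⟩ := H x
    rw [hξ, hl] at hA
    have hsat : Λ.OSSat (fun p => {y | Λ.Sat ζ p.2 y}) (ζ y) (starConj sh (B x)) := by
      intro q hq
      obtain ⟨χ, hχ, hq⟩ := mem_starConj.1 hq
      exact (sat_iff_star (sh := sh)).1 (hxy χ hχ) q hq
    refine Λ.lift_mono h ?_ (hw.2 Y _ _ hsat h _ hA)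
    rintro y' ⟨z, hz, hzy⟩
    refine ⟨g z, hz, fun χ hχ => ?_⟩
    obtain ⟨p, hp, rfl⟩ := (hB z χ).1 hχ
    exact hzy p hp
  · rintro ⟨S, hS, hry⟩
    refine hS.sat hry (truth φ r fun q hq => ?_)
    rw [hr]
    exact mem_starConj.2 ⟨φ, by simp, hq⟩

/-! ### Encodings are injective -/

theorem encForm_injective : Function.Injective Λ.encForm := by
  intro φ
  induction φ with
  | top => rintro (_ | _ | _) h <;> simp_all [encForm]
  | and φ ψ ih1 ih2 =>
    rintro (_ | ⟨φ', ψ'⟩ | _) h <;> simp only [encForm, Dat.cons.injEq, reduceCtorEq,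
      false_and, true_and] at h
    rw [ih1 h.1, ih2 h.2]
  | mod m φ ih =>
    rintro (_ | _ | ⟨m', φ'⟩) h <;> simp only [encForm, Dat.cons.injEq, reduceCtorEq,
      false_and, true_and] at h
    rw [Λ.code_injective h.1, ih h.2]

theorem encVar_injective : Function.Injective Λ.encVar := by
  rintro ⟨_ | m, φ⟩ ⟨_ | m', φ'⟩ h <;>
    simp only [encVar, Dat.cons.injEq, reduceCtorEq, false_and, true_and] at h
  · rw [encForm_injective h]
  · rw [Λ.code_injective h.1, encForm_injective h.2]

theorem encOS_injective : Function.Injective Λ.encOS := by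
  refine encList_injective ?_
  rintro ⟨m, a⟩ ⟨m', a'⟩ h
  simp only [encPair, Dat.cons.injEq] at h
  rw [Λ.code_injective h.1, encVar_injective h.2]

/-! ### Abstract models from one-step procedures -/

/-- The state named by a list of variables: it stores the one-step formula of the conjunction of
the formulas substituted for these variables. Its successors are named by the variables they
satisfy. -/
def stateNode (Λ : ModalStructure T) (sh : Bool)
    (succs : List (Var Λ.Mod) → List (List (Var Λ.Mod))) (vs : List (Var Λ.Mod)) :
    AbsNode Λ.Mod where
  name := encList Λ.encVar vs
  form := starConj sh (vs.map Prod.snd)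
  succ := (succs vs).map fun b => (encList Λ.encVar b, b)

theorem PresentsOSWsi.nodup {V : Type} {φ : OSForm Λ.Mod V} {xs : List (List V)}
    (h : Λ.PresentsOSWsi φ xs) : xs.Nodup :=
  List.nodup_iff_injective_get.2 fun i j hij => h.2.1 i j fun a => by rw [hij]

/-- A set `N` of lists of variables that contains the root and is closed under the successors
given by a one-step procedure is an abstract wsi model. -/
theorem isAbstractWsi_of_closed {succs : List (Var Λ.Mod) → List (List (Var Λ.Mod))}
    {N : List (List (Var Λ.Mod))} {φ : Form Λ.Mod} (hN : N.Nodup) (hroot : [(none, φ)] ∈ N)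
    (hcl : ∀ vs ∈ N, ∀ b ∈ succs vs, b ∈ N)
    (hp : ∀ vs ∈ N, Λ.PresentsOSWsi (starConj sh (vs.map Prod.snd)) (succs vs)) :
    Λ.IsAbstractWsi sh
      ⟨encList Λ.encVar [(none, φ)], N.map (Λ.stateNode sh succs)⟩ φ := by
  have hinj : Function.Injective (encList Λ.encVar) := encList_injective encVar_injective
  set 𝔄 : AbsModel Λ.Mod := ⟨encList Λ.encVar [(none, φ)], N.map (Λ.stateNode sh succs)⟩ with h𝔄
  have hst : ∀ s : 𝔄.State, ∃ vs ∈ N, encList Λ.encVar vs = s.1 := by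
    rintro ⟨s, n, hn, rfl⟩
    obtain ⟨vs, hvs, rfl⟩ := List.mem_map.1 hn
    exact ⟨vs, hvs, rfl⟩
  choose lab hlabN hlab using hst
  have hmk : ∀ vs ∈ N, ∃ s : 𝔄.State, s.1 = encList Λ.encVar vs ∧ lab s = vs := fun vs hvs =>
    ⟨⟨encList Λ.encVar vs, _, List.mem_map_of_mem hvs, rfl⟩, rfl, hinj (hlab _)⟩
  -- the transition at the state `vs` is induced by the one-step model presented by `succs vs`
  have hloc : ∀ vs ∈ N, ∃ t : T (𝔄.Succ (Λ.stateNode sh succs vs)),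
      Λ.IsOSWsi (𝔄.val (Λ.stateNode sh succs vs)) t (starConj sh (vs.map Prod.snd)) := by
    intro vs hvs
    obtain ⟨-, -, t, ht⟩ := hp vs hvs
    have : ∀ i : Fin (succs vs).length, ∃ s : 𝔄.Succ (Λ.stateNode sh succs vs),
        s.1.1 = encList Λ.encVar ((succs vs).get i) := fun i => by
      obtain ⟨s, hs, -⟩ := hmk _ (hcl vs hvs _ (List.get_mem _ i))
      exact ⟨⟨s, _, List.mem_map_of_mem (List.get_mem _ i), hs.symm⟩, hs⟩
    choose g hg using this
    refine ⟨g <$> t, ht.map g ?_ ?_⟩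
    · rintro i p ⟨e, he, h1, h2⟩
      obtain ⟨b, hb, rfl⟩ := List.mem_map.1 he
      have : b = (succs vs).get i := hinj (h1.trans (hg i))
      subst this
      exact h2
    · intro a _ i hi
      exact ⟨_, List.mem_map_of_mem (List.get_mem _ i), (hg i).symm, hi⟩
  choose t ht using hloc
  refine ⟨?_, ?_, fun s => (fun z => z.1) <$> t (lab s) (hlabN s), ?_⟩
  · rw [h𝔄, List.map_map]
    exact hN.map hinj
  · intro n hn
    obtain ⟨vs, hvs, rfl⟩ := List.mem_map.1 hn
    refine ⟨?_, ?_⟩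
    · simp only [stateNode, List.map_map]
      exact (hp vs hvs).nodup.map hinj
    · intro e he
      obtain ⟨b, hb, rfl⟩ := List.mem_map.1 he
      exact ⟨((hp vs hvs).1 b hb).2, _, List.mem_map_of_mem (hcl vs hvs b hb), rfl,
        fun q => Iff.rfl⟩
  · obtain ⟨r, hr, hrl⟩ := hmk _ hroot
    refine ⟨r, hr, ?_, ?_, ?_⟩
    · intro n hn hroot' q
      obtain ⟨vs, hvs, rfl⟩ := List.mem_map.1 hn
      obtain rfl : vs = [(none, φ)] := hinj hroot'
      simp [stateNode, starConj]
    · intro n hn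
      obtain ⟨vs, hvs, rfl⟩ := List.mem_map.1 hn
      have : lab ⟨(Λ.stateNode sh succs vs).name, _, hn, rfl⟩ = vs := hinj (hlab _)
      have key : ∀ us (hus : us ∈ N), us = vs →
          (fun z => z.1) <$> t us hus = (fun z => z.1) <$> t vs hvs := by
        rintro _ _ rfl; rfl
      exact ⟨t vs hvs, key _ _ this, ht vs hvs⟩
    · refine isWsi_of_labelling (sh := sh) (fun s => (lab s).map Prod.snd) (fun s => ?_)
        (by rw [hrl]; rfl)
      refine ⟨_, _, t (lab s) (hlabN s), fun z => z.1, rfl, ht _ _, fun z χ => ?_⟩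
      rw [List.mem_map]
      refine exists_congr fun p => and_congr_left fun _ => ?_
      constructor
      · intro hpz
        obtain ⟨e, he, h1⟩ := z.2
        obtain ⟨b, hb, rfl⟩ := List.mem_map.1 he
        have : b = lab z.1 := hinj (h1.trans (hlab z.1).symm)
        exact ⟨_, he, h1, this ▸ hpz⟩
      · rintro ⟨e, he, h1, h2⟩
        obtain ⟨b, hb, rfl⟩ := List.mem_map.1 he
        have : b = lab z.1 := hinj (h1.trans (hlab z.1).symm)
        exact this ▸ h2

/-! ### Computing one-step formulas -/

section Star

variable {M : Type}

/-- One step of the computation of `starConj`: the stack holds the formulas that remain to be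
decomposed, with the rightmost one on top, and atoms are collected in front of the output. -/
def starStep (sh : Bool) : List (Form M) × OSForm M (Var M) → List (Form M) × OSForm M (Var M)
  | ([], o) => ([], o)
  | (.top :: l, o) => (l, o)
  | (.and φ ψ :: l, o) => (ψ :: φ :: l, o)
  | (.mod h φ :: l, o) => (l, (h, mkVar sh h φ) :: o)

theorem starStep_invariant (s : List (Form M) × OSForm M (Var M)) :
    starConj sh (starStep sh s).1.reverse ++ (starStep sh s).2 =
      starConj sh s.1.reverse ++ s.2 := by
  rcases s with ⟨_ | ⟨_ | _ | _, l⟩, o⟩ <;>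
    simp [starStep, starConj, Form.star]

end Star

theorem encVar_mkVar_le (h : Λ.Mod) (χ : Form Λ.Mod) :
    (Λ.encVar (mkVar sh h χ)).size ≤ 3 + (Λ.code h).size + (Λ.encForm χ).size := by
  cases sh <;> simp [mkVar, encVar, Dat.size] <;> omega

theorem size_starStep (s : List (Form Λ.Mod) × OSForm Λ.Mod (Var Λ.Mod)) :
    2 * (encList Λ.encForm (starStep sh s).1).size + (Λ.encOS (starStep sh s).2).size ≤
      2 * (encList Λ.encForm s.1).size + (Λ.encOS s.2).size := by
  rcases s with ⟨_ | ⟨_ | _ | ⟨h, φ⟩, l⟩, o⟩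
  · exact le_rfl
  · simp only [starStep, encList, encForm, Dat.size]; omega
  · simp only [starStep, encList, encForm, Dat.size]; omega
  · have := encVar_mkVar_le (sh := sh) h φ
    simp only [starStep, encOS, encList, encForm, encPair, Dat.size]; omega

theorem starStep_decreasing (s : List (Form Λ.Mod) × OSForm Λ.Mod (Var Λ.Mod)) :
    (starStep sh s).1 = [] ∨
      (encList Λ.encForm (starStep sh s).1).size + 1 ≤ (encList Λ.encForm s.1).size := by
  rcases s with ⟨_ | ⟨_ | _ | ⟨h, φ⟩, l⟩, o⟩
  · exact .inl rfl
  all_goals right; simp only [starStep, encList, encForm, Dat.size]; omega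

theorem polyTime_starStep (O : Dat → Dat) :
    PolyTime O (fun s : List (Form Λ.Mod) × OSForm Λ.Mod (Var Λ.Mod) =>
        .cons (encList Λ.encForm s.1) (Λ.encOS s.2))
      fun s => .cons (encList Λ.encForm (starStep sh s).1) (Λ.encOS (starStep sh s).2) := by
  have D := PolyTime.id (O := O) (x := fun s : List (Form Λ.Mod) × OSForm Λ.Mod (Var Λ.Mod) =>
    Dat.cons (encList Λ.encForm s.1) (Λ.encOS s.2))
  have φ := D.fst.fst
  have l := D.fst.snd
  have o := D.snd
  have v : PolyTime O (fun s : List (Form Λ.Mod) × OSForm Λ.Mod (Var Λ.Mod) =>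
        Dat.cons (encList Λ.encForm s.1) (Λ.encOS s.2))
      fun s => if sh then .nil else .cons .nil (encList Λ.encForm s.1).fst.snd.fst := by
    cases sh
    exacts [.cons .nil φ.snd.fst, .nil]
  refine (PolyTime.ite_eq D.fst .nil D (.ite_eq φ .nil (l.cons o) (.ite_eq φ.fst .nil
    ((φ.snd.snd.cons (φ.snd.fst.cons l)).cons o)
    (l.cons ((φ.snd.fst.cons (v.cons φ.snd.snd)).cons o))))).congr (fun _ => rfl) ?_
  rintro ⟨_ | ⟨_ | _ | ⟨h, φ⟩, l⟩, o⟩ <;> cases sh <;>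
    simp [starStep, encOS, encList, encForm, encPair, encVar, mkVar, Dat.fst, Dat.snd]

theorem polyTime_starConj (O : Dat → Dat) :
    PolyTime O (fun B : List (Form Λ.Mod) => encList Λ.encForm B)
      fun B => Λ.encOS (starConj sh B) := by
  let st : List (Form Λ.Mod) → ℕ → List (Form Λ.Mod) × OSForm Λ.Mod (Var Λ.Mod) :=
    fun B j => (starStep sh)^[j] (B.reverse, [])
  have hst : ∀ B j, st B (j + 1) = starStep sh (st B j) :=
    fun B j => Function.iterate_succ_apply' _ _ _
  have hrev : ∀ B : List (Form Λ.Mod),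
      (encList Λ.encForm B.reverse).size = (encList Λ.encForm B).size := fun B => by
    simp [size_encList, List.sum_reverse]
  have hinv : ∀ B j, starConj sh (st B j).1.reverse ++ (st B j).2 = starConj sh B := by
    intro B j
    induction j with
    | zero => simp [st]
    | succ j ih => rw [hst, starStep_invariant, ih]
  have hsize : ∀ B j, 2 * (encList Λ.encForm (st B j).1).size + (Λ.encOS (st B j).2).size ≤
      2 * (encList Λ.encForm B).size + 1 := by
    intro B j
    induction j with
    | zero => simp [st, hrev, encOS, encList, Dat.size]
    | succ j ih => rw [hst]; exact (size_starStep _).trans ih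
  have hdec : ∀ B j, (st B j).1 = [] ∨
      (encList Λ.encForm (st B j).1).size + j ≤ (encList Λ.encForm B).size := by
    intro B j
    induction j with
    | zero => right; simp [st, hrev]
    | succ j ih =>
      rw [hst]
      rcases ih with ih | ih
      · left
        rcases h : st B j with ⟨l, o⟩
        rw [h] at ih
        subst ih
        rfl
      · rcases starStep_decreasing (sh := sh) (st B j) with h | h
        · exact .inl h
        · right; omega
  refine (PolyTime.iterate (x := fun B => encList Λ.encForm B)
    (acc := fun B j => .cons (encList Λ.encForm (st B j).1) (Λ.encOS (st B j).2))
    ((PolyTime.reverse Λ.encForm (l := fun B => B) .id).cons .nil) ?_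
    (m := fun B => 2 + 2 * (encList Λ.encForm B).size)
    ((PolyBdd.const 2 _).add ((PolyBdd.const 2 _).mul (.refl _))) ?_).snd.congr
    (fun _ => rfl) fun B => ?_
  · simp only [hst]
    exact PolyTime.id.snd.comp ((polyTime_starStep O).reindex
      fun k : Σ B : List (Form Λ.Mod), Fin (encList Λ.encForm B).size => st k.1 k.2)
  · intro B j _
    have := hsize B j
    simp only [Dat.size]; omega
  · have h : (st B (encList Λ.encForm B).size).1 = [] := by
      rcases hdec B (encList Λ.encForm B).size with h | h
      · exact h
      · have := (encList Λ.encForm (st B (encList Λ.encForm B).size).1).one_le_size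
        omega
    have := hinv B (encList Λ.encForm B).size
    rw [h] at this
    rw [← this]
    rfl

/-! ### Weights -/

/-- The weight of a list of variables; its encoding has one node more. -/
def weight (Λ : ModalStructure T) (vs : List (Var Λ.Mod)) : ℕ :=
  (vs.map fun a => 1 + (Λ.encVar a).size).sum

theorem size_encVars (vs : List (Var Λ.Mod)) :
    (encList Λ.encVar vs).size = 1 + Λ.weight vs := size_encList _ _

theorem weight_append (vs vs' : List (Var Λ.Mod)) :
    Λ.weight (vs ++ vs') = Λ.weight vs + Λ.weight vs' := by
  simp [weight]

theorem weight_cons (a : Var Λ.Mod) (vs : List (Var Λ.Mod)) :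
    Λ.weight (a :: vs) = 1 + (Λ.encVar a).size + Λ.weight vs := by
  simp [weight]

theorem weight_le_of_nodup {b vs : List (Var Λ.Mod)} (hb : b.Nodup) (h : b ⊆ vs) :
    Λ.weight b ≤ Λ.weight vs := by
  obtain ⟨l, hl, hs⟩ := List.subperm_of_subset hb h
  unfold weight
  rw [← (hl.map _).sum_eq]
  exact (hs.map _).sum_le_sum (by simp)

theorem weight_vars_star_le (φ : Form Λ.Mod) :
    Λ.weight (OSForm.vars (φ.star sh)) ≤ (Λ.encForm φ).size := by
  induction φ with
  | top => simp [Form.star, OSForm.vars, weight]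
  | and φ ψ ih1 ih2 =>
    have : OSForm.vars ((Form.and φ ψ).star sh) =
      OSForm.vars (φ.star sh) ++ OSForm.vars (ψ.star sh) := List.map_append
    rw [this, weight_append]
    simp only [encForm, Dat.size]; omega
  | mod h φ =>
    have := encVar_mkVar_le (sh := sh) h φ
    have h' : OSForm.vars ((Form.mod h φ).star sh) = [mkVar sh h φ] := rfl
    rw [h', weight_cons]
    simp only [weight, encForm, Dat.size, List.map_nil, List.sum_nil]; omega

/-- The variables of the one-step formula stored at a state weigh no more than the state. -/
theorem weight_vars_le (vs : List (Var Λ.Mod)) :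
    Λ.weight (OSForm.vars (starConj sh (vs.map Prod.snd))) ≤ Λ.weight vs := by
  induction vs with
  | nil => simp [starConj, OSForm.vars, weight]
  | cons a vs ih =>
    have : OSForm.vars (starConj sh ((a :: vs).map Prod.snd)) =
      OSForm.vars (a.2.star sh) ++ OSForm.vars (starConj sh (vs.map Prod.snd)) := List.map_append
    rw [this, weight_append, weight_cons]
    have h1 := weight_vars_star_le (sh := sh) a.2
    have h2 : (Λ.encForm a.2).size ≤ (Λ.encVar a).size := by
      rcases a with ⟨_ | h, χ⟩ <;> simp only [encVar, Dat.size] <;> omega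
    omega

theorem osSize_starConj_le (B : List (Form Λ.Mod)) :
    Λ.osSize (starConj sh B) ≤ (B.map fun φ => (Λ.encForm φ).size).sum := by
  have h1 : ∀ φ : Form Λ.Mod, Λ.osSize (φ.star sh) ≤ (Λ.encForm φ).size := by
    intro φ
    induction φ with
    | top => simp [Form.star, osSize]
    | and φ ψ ih1 ih2 =>
      simp only [osSize, Form.star, encForm, Dat.size, List.map_append, List.sum_append] at *
      omega
    | mod h φ => simp [osSize, Form.star, encForm, Dat.size]; omega
  induction B with
  | nil => simp [starConj, osSize]
  | cons φ B ih =>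
    have := h1 φ
    have h2 : starConj sh (φ :: B) = φ.star sh ++ starConj sh B := rfl
    simp only [osSize, h2, List.map_append, List.sum_append, List.map_cons, List.sum_cons] at *
    omega

theorem osSize_le_weight (vs : List (Var Λ.Mod)) :
    Λ.osSize (starConj sh (vs.map Prod.snd)) ≤ Λ.weight vs := by
  refine (osSize_starConj_le _).trans ?_
  rw [List.map_map, weight]
  refine List.sum_le_sum fun a _ => ?_
  rcases a with ⟨_ | h, χ⟩ <;> simp only [encVar, Dat.size, Function.comp] <;> omega

theorem weight_vars_le_encOS (φ : OSForm Λ.Mod (Var Λ.Mod)) :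
    1 + Λ.weight φ.vars ≤ (Λ.encOS φ).size := by
  rw [encOS, size_encList, weight, OSForm.vars, List.map_map]
  refine Nat.add_le_add_left (List.sum_le_sum fun a _ => ?_) 1
  simp only [encPair, Dat.size, Function.comp]; omega

theorem osSize_le_encOS (φ : OSForm Λ.Mod (Var Λ.Mod)) : Λ.osSize φ ≤ (Λ.encOS φ).size := by
  rw [encOS, size_encList, osSize]
  refine le_add_left (List.sum_le_sum fun a _ => ?_)
  simp only [encPair, Dat.size]; omega

theorem weight_root (φ : Form Λ.Mod) :
    Λ.weight [((none, φ) : Var Λ.Mod)] = 3 + (Λ.encForm φ).size := by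
  simp only [weight, encVar, Dat.size, List.map_cons, List.map_nil, List.sum_cons, List.sum_nil]
  omega

theorem PresentsOSWsi.weight_le {vs b : List (Var Λ.Mod)} {xs : List (List (Var Λ.Mod))}
    (h : Λ.PresentsOSWsi (starConj sh (vs.map Prod.snd)) xs) (hb : b ∈ xs) :
    Λ.weight b ≤ Λ.weight vs :=
  (weight_le_of_nodup (h.1 b hb).1 (h.1 b hb).2).trans (weight_vars_le vs)

theorem PresentsOSWsi.relevant {L : Set (Form Λ.Mod)} {B : List (Form Λ.Mod)}
    {xs : List (List (Var Λ.Mod))} (h : Λ.PresentsOSWsi (starConj sh B) xs) (hB : Relevant L B)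
    {b : List (Var Λ.Mod)} (hb : b ∈ xs) : Relevant L (b.map Prod.snd) := by
  refine hB.step fun χ hχ => ?_
  obtain ⟨a, ha, rfl⟩ := List.mem_map.1 hχ
  obtain ⟨φ, hφ, h'⟩ := mem_vars_starConj.1 ((h.1 b hb).2 a ha)
  exact ⟨φ, hφ, Form.snd_mem_args h'⟩

theorem PresentsOSWsi.depth_lt {vs b : List (Var Λ.Mod)} {xs : List (List (Var Λ.Mod))}
    (h : Λ.PresentsOSWsi (starConj sh (vs.map Prod.snd)) xs) (hb : b ∈ xs) {a : Var Λ.Mod}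
    (ha : a ∈ b) : ∃ v ∈ vs, a.2.depth < v.2.depth := by
  obtain ⟨φ, hφ, h'⟩ := mem_vars_starConj.1 ((h.1 b hb).2 a ha)
  obtain ⟨v, hv, rfl⟩ := List.mem_map.1 hφ
  exact ⟨v, hv, Form.depth_lt_of_mem_args (Form.snd_mem_args h')⟩

theorem depth_le_size (φ : Form Λ.Mod) : φ.depth + 1 ≤ (Λ.encForm φ).size := by
  induction φ with
  | top => simp [Form.depth, encForm, Dat.size]
  | and φ ψ ih1 ih2 => simp only [Form.depth, encForm, Dat.size]; omega
  | mod h φ ih => simp only [Form.depth, encForm, Dat.size]; omega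

/-! ### The states reachable from the root -/

section Reachable

variable (ans : List (Form Λ.Mod) → List (List (Var Λ.Mod)))

/-- The lists of variables reachable in at most `j` steps from the root of the abstract model
of `φ`, where the answer `ans B` of a one-step procedure for `B` lists the successors. -/
noncomputable def reach (φ : Form Λ.Mod) : ℕ → List (List (Var Λ.Mod))
  | 0 => [[(none, φ)]]
  | j + 1 => listUnion ((reach φ j).flatMap fun vs => ans (vs.map Prod.snd)) (reach φ j)

variable {ans} {L : Set (Form Λ.Mod)} {φ : Form Λ.Mod}

theorem mem_reach_succ {j : ℕ} {b : List (Var Λ.Mod)} :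
    b ∈ reach ans φ (j + 1) ↔
      (∃ vs ∈ reach ans φ j, b ∈ ans (vs.map Prod.snd)) ∨ b ∈ reach ans φ j := by
  rw [reach, mem_listUnion, List.mem_flatMap]

theorem root_mem_reach (j : ℕ) : [(none, φ)] ∈ reach ans φ j := by
  induction j with
  | zero => simp [reach]
  | succ j ih => exact mem_reach_succ.2 (.inr ih)

theorem nodup_reach (j : ℕ) : (reach ans φ j).Nodup := by
  induction j with
  | zero => simp [reach]
  | succ j ih => exact nodup_listUnion _ ih

/-- A property of the root that is inherited by the successors of relevant states holds at all
reachable states, all of which are relevant. -/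
theorem reach_induction (hφ : φ ∈ L)
    (hpres : ∀ B, Relevant L B → Λ.PresentsOSWsi (starConj sh B) (ans B))
    {p : List (Var Λ.Mod) → Prop} (h0 : p [(none, φ)])
    (hs : ∀ vs, p vs → Relevant L (vs.map Prod.snd) → ∀ b ∈ ans (vs.map Prod.snd), p b)
    {j : ℕ} {vs : List (Var Λ.Mod)} (h : vs ∈ reach ans φ j) :
    p vs ∧ Relevant L (vs.map Prod.snd) := by
  induction j generalizing vs with
  | zero =>
    obtain rfl : vs = [(none, φ)] := by simpa [reach] using h
    exact ⟨h0, .base hφ⟩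
  | succ j ih =>
    rcases mem_reach_succ.1 h with ⟨u, hu, hb⟩ | h
    · obtain ⟨h1, h2⟩ := ih hu
      exact ⟨hs u h1 h2 vs hb, (hpres _ h2).relevant h2 hb⟩
    · exact ih h

theorem weight_le_of_mem_reach (hφ : φ ∈ L)
    (hpres : ∀ B, Relevant L B → Λ.PresentsOSWsi (starConj sh B) (ans B))
    {j : ℕ} {vs : List (Var Λ.Mod)} (h : vs ∈ reach ans φ j) :
    Λ.weight vs ≤ 3 + (Λ.encForm φ).size :=
  (reach_induction hφ hpres (p := fun vs => Λ.weight vs ≤ 3 + (Λ.encForm φ).size)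
    (weight_root φ).le (fun _ h1 h2 _ hb => ((hpres _ h2).weight_le hb).trans h1) h).1

/-- As the modal depth decreases along transitions, states reached late satisfy no variables, and
so do their successors. -/
theorem reach_closed (hφ : φ ∈ L)
    (hpres : ∀ B, Relevant L B → Λ.PresentsOSWsi (starConj sh B) (ans B))
    {j : ℕ} (hj : φ.depth < j) {vs : List (Var Λ.Mod)} (h : vs ∈ reach ans φ j)
    {b : List (Var Λ.Mod)} (hb : b ∈ ans (vs.map Prod.snd)) : b ∈ reach ans φ j := by
  have key : ∀ j, ∀ vs ∈ reach ans φ j, (∀ b ∈ ans (vs.map Prod.snd), b ∈ reach ans φ j) ∨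
      ∀ a ∈ vs, a.2.depth + j ≤ φ.depth := by
    intro j
    induction j with
    | zero =>
      intro vs hvs
      obtain rfl : vs = [(none, φ)] := by simpa [reach] using hvs
      right; simp
    | succ j ih =>
      have old : ∀ u ∈ reach ans φ j, ∀ b ∈ ans (u.map Prod.snd), b ∈ reach ans φ (j + 1) :=
        fun u hu b hb => mem_reach_succ.2 (.inl ⟨u, hu, hb⟩)
      intro vs hvs
      rcases mem_reach_succ.1 hvs with ⟨u, hu, hvu⟩ | hvs
      · rcases ih u hu with hu' | hu'
        · exact .inl (old vs (hu' vs hvu))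
        · right
          intro a ha
          have hr := (reach_induction hφ hpres (p := fun _ => True) trivial
            (fun _ _ _ _ _ => trivial) hu).2
          obtain ⟨v, hv, hlt⟩ := (hpres _ hr).depth_lt hvu ha
          have := hu' v hv
          omega
      · exact .inl (old vs hvs)
  rcases key j vs h with h' | h'
  · exact h' b hb
  · obtain rfl : vs = [] := List.eq_nil_iff_forall_not_mem.2 fun a ha => by
      have := h' a ha; omega
    have hr := (reach_induction hφ hpres (p := fun _ => True) trivial
      (fun _ _ _ _ _ => trivial) h).2
    obtain rfl : b = [] := List.eq_nil_iff_forall_not_mem.2 fun a ha => by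
      simpa using (hpres _ hr).depth_lt hb ha
    exact h

end Reachable

/-! ### Abstract models in polynomial time -/

/-- A one-step procedure that runs in polynomial time yields abstract wsi models in polynomial
time, provided that the states reachable from the root lie in a set of polynomial size. -/
theorem admitsPolyWsiRel_of_procedure {O : Dat → Dat} {L : Set (Form Λ.Mod)}
    {ans : List (Form Λ.Mod) → List (List (Var Λ.Mod))}
    (hans : PolyTime O (fun B : {B // Relevant L B} => Λ.encOS (starConj sh B.1))
      fun B => Λ.encPres (ans B.1))
    (hpres : ∀ B, Relevant L B → Λ.PresentsOSWsi (starConj sh B) (ans B))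
    (S : L → Finset (List (Var Λ.Mod))) (hroot : ∀ φ : L, [(none, φ.1)] ∈ S φ)
    (hS : ∀ φ : L, ∀ vs ∈ S φ, Relevant L (vs.map Prod.snd) →
      ∀ b ∈ ans (vs.map Prod.snd), b ∈ S φ)
    (hcard : PolyBdd (fun φ : L => (S φ).card) fun φ => (Λ.encForm φ.1).size) :
    Λ.AdmitsPolyWsiRel sh O L := by
  let eV : List (Var Λ.Mod) → Dat := encList Λ.encVar
  have heV : Function.Injective eV := encList_injective encVar_injective
  let N : L → ℕ → List (List (Var Λ.Mod)) := fun φ j => reach ans φ.1 j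
  have hrel : ∀ (φ : L) j, ∀ vs ∈ N φ j, Relevant L (vs.map Prod.snd) := fun φ j vs hvs =>
    (reach_induction φ.2 hpres (p := fun _ => True) trivial (fun _ _ _ _ _ => trivial) hvs).2
  have hlen : ∀ (φ : L) j, (N φ j).length ≤ (S φ).card := fun φ j => by
    classical
    rw [← List.toFinset_card_of_nodup (nodup_reach (ans := ans) j)]
    exact Finset.card_le_card fun vs hvs =>
      (reach_induction φ.2 hpres (hroot φ) (hS φ) (List.mem_toFinset.1 hvs)).1
  -- polynomial-time computations: the conjunction of a state, its one-step formula, its successors,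
  -- the set of all states, and finally the model
  have hargs : PolyTime O (fun vs : List (Var Λ.Mod) => eV vs)
      fun vs => encList Λ.encForm (vs.map Prod.snd) := by
    refine PolyTime.map Λ.encVar Λ.encForm .id ?_
    refine PolyTime.id.snd.snd.congr (fun _ => rfl) ?_
    rintro ⟨⟨vs, _ | h, χ⟩, _⟩ <;> rfl
  have hstar : PolyTime O (fun vs : List (Var Λ.Mod) => eV vs)
      fun vs => Λ.encOS (starConj sh (vs.map Prod.snd)) :=
    hargs.comp ((polyTime_starConj O).reindex fun vs : List (Var Λ.Mod) => vs.map Prod.snd)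
  have hsucc : PolyTime O (fun vs : {vs : List (Var Λ.Mod) // Relevant L (vs.map Prod.snd)} =>
      eV vs.1) fun vs => Λ.encPres (ans (vs.1.map Prod.snd)) :=
    (hstar.reindex _).comp (hans.reindex
      fun vs : {vs : List (Var Λ.Mod) // Relevant L (vs.map Prod.snd)} => ⟨_, vs.2⟩)
  have hreach : PolyTime O (fun φ : L => Λ.encForm φ.1)
      fun φ => encList eV (N φ (Λ.encForm φ.1).size) := by
    -- the size of the input exceeds the modal depth, so this many iterations suffice
    refine PolyTime.iterate (acc := fun φ j => encList eV (N φ j)) ?_ ?_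
      (m := fun φ => 1 + (S φ).card * (1 + (4 + (Λ.encForm φ.1).size))) ?_ ?_
    · exact .cons (.cons (.cons .nil .id) .nil) .nil
    · have hN : PolyTime O (fun k : Σ φ : L, Fin (Λ.encForm φ.1).size =>
          .cons (Λ.encForm k.1.1) (encList eV (N k.1 k.2))) fun k => encList eV (N k.1 k.2) :=
        PolyTime.id.snd
      refine PolyTime.union heV (PolyTime.flatMap eV eV
        (f := fun _ vs => ans (vs.map Prod.snd)) hN ?_) hN
      exact PolyTime.id.snd.comp (hsucc.reindex fun k :
        {k : (Σ φ : L, Fin (Λ.encForm φ.1).size) × List (Var Λ.Mod) // k.2 ∈ N k.1.1 k.1.2} =>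
        ⟨k.1.2, hrel _ _ _ k.2⟩)
    · exact (PolyBdd.const 1 _).add (hcard.mul ((PolyBdd.const 1 _).add
        ((PolyBdd.const 4 _).add (.refl _))))
    · intro φ j _
      refine (encList_le_of_forall eV (m := 4 + (Λ.encForm φ.1).size) fun vs hvs => ?_).trans
        (Nat.add_le_add_left (Nat.mul_le_mul_right _ (hlen φ j)) 1)
      have := weight_le_of_mem_reach φ.2 hpres hvs
      simp only [eV, size_encVars]; omega
  have hnode : PolyTime O (fun vs : {vs : List (Var Λ.Mod) // Relevant L (vs.map Prod.snd)} =>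
      eV vs.1) fun vs => Λ.encNode (Λ.stateNode sh (fun vs => ans (vs.map Prod.snd)) vs.1) := by
    refine PolyTime.id.cons ((hstar.reindex _).cons ?_)
    exact PolyTime.map eV (encPair _root_.id (encList Λ.encVar))
      (f := fun _ b => (encList Λ.encVar b, b)) hsucc (PolyTime.id.snd.cons PolyTime.id.snd)
  have hmodel : PolyTime O (fun φ : L => Λ.encForm φ.1) fun φ => Λ.encAbs
      ⟨encList Λ.encVar [(none, φ.1)], (N φ (Λ.encForm φ.1).size).map
        (Λ.stateNode sh fun vs => ans (vs.map Prod.snd))⟩ := by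
    refine .cons (.cons (.cons .nil .id) .nil) (PolyTime.map eV Λ.encNode
      (f := fun _ => Λ.stateNode sh fun vs => ans (vs.map Prod.snd)) hreach ?_)
    exact PolyTime.id.snd.comp (hnode.reindex fun k :
      {k : L × List (Var Λ.Mod) // k.2 ∈ N k.1 (Λ.encForm k.1.1).size} =>
      ⟨k.1.2, hrel _ _ _ k.2⟩)
  refine hmodel.solves ?_
  rintro _ ⟨φ, hφ, rfl⟩
  refine ⟨⟨φ, hφ⟩, rfl, fun φ' hφ' h => ?_⟩
  obtain rfl := encForm_injective h
  exact ⟨_, rfl, isAbstractWsi_of_closed (nodup_reach _) (root_mem_reach _)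
    (fun vs hvs b hb => reach_closed hφ hpres (depth_le_size φ) hvs hb)
    fun vs hvs => hpres _ (hrel ⟨φ, hφ⟩ _ vs hvs)⟩

/-! ### Counting states level by level -/

section Levels

variable (ans : List (Form Λ.Mod) → List (List (Var Λ.Mod)))

/-- The lists of variables at distance `j` from the root of the tree unravelling of the abstract
model of `φ`, with multiplicities. -/
def level (φ : Form Λ.Mod) : ℕ → List (List (Var Λ.Mod))
  | 0 => [[(none, φ)]]
  | j + 1 => (level φ j).flatMap fun vs => ans (vs.map Prod.snd)

variable {ans} {L : Set (Form Λ.Mod)} {φ : Form Λ.Mod}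

theorem level_spec (hφ : φ ∈ L)
    (hpres : ∀ B, Relevant L B → Λ.PresentsOSWsi (starConj sh B) (ans B))
    {j : ℕ} {vs : List (Var Λ.Mod)} (h : vs ∈ level ans φ j) :
    Relevant L (vs.map Prod.snd) ∧ Λ.weight vs ≤ 3 + (Λ.encForm φ).size ∧
      ∀ a ∈ vs, a.2.depth + j ≤ φ.depth := by
  induction j generalizing vs with
  | zero =>
    obtain rfl : vs = [(none, φ)] := by simpa [level] using h
    exact ⟨.base hφ, (weight_root φ).le, by simp⟩
  | succ j ih =>
    obtain ⟨u, hu, hb⟩ := List.mem_flatMap.1 h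
    obtain ⟨h1, h2, h3⟩ := ih hu
    refine ⟨(hpres _ h1).relevant h1 hb, ((hpres _ h1).weight_le hb).trans h2, fun a ha => ?_⟩
    obtain ⟨v, hv, hlt⟩ := (hpres _ h1).depth_lt hb ha
    have := h3 v hv
    omega

/-- It suffices to bound, on every level, the number of states that satisfy some variable: the
remaining ones all coincide with the empty list. -/
theorem admitsPolyWsiRel_of_levels {O : Dat → Dat}
    (hans : PolyTime O (fun B : {B // Relevant L B} => Λ.encOS (starConj sh B.1))
      fun B => Λ.encPres (ans B.1))
    (hpres : ∀ B, Relevant L B → Λ.PresentsOSWsi (starConj sh B) (ans B))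
    {m : L → ℕ} (hm : PolyBdd m fun φ => (Λ.encForm φ.1).size)
    (hlev : ∀ φ : L, ∀ j ≤ φ.1.depth,
      ((level ans φ.1 j).filter (!·.isEmpty)).length ≤ m φ) :
    Λ.AdmitsPolyWsiRel sh O L := by
  classical
  let S : L → Finset (List (Var Λ.Mod)) := fun φ =>
    insert [] ((Finset.range (φ.1.depth + 1)).biUnion fun j =>
      ((level ans φ.1 j).filter (!·.isEmpty)).toFinset)
  have hmem : ∀ (φ : L) (vs : List (Var Λ.Mod)),
      vs ∈ S φ ↔ vs = [] ∨ ∃ j ≤ φ.1.depth, vs ∈ level ans φ.1 j := by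
    intro φ vs
    rcases vs with _ | ⟨a, vs⟩ <;> simp [S]
  refine admitsPolyWsiRel_of_procedure hans hpres S
    (fun φ => (hmem _ _).2 (.inr ⟨0, Nat.zero_le _, by simp [level]⟩)) ?_ ?_
  · intro φ vs hvs hr b hb
    rcases List.eq_nil_or_concat b with rfl | hne
    · exact (hmem _ _).2 (.inl rfl)
    obtain ⟨a, ha⟩ : ∃ a, a ∈ b := by
      obtain ⟨l, a, rfl⟩ := hne
      exact ⟨a, by simp⟩
    obtain ⟨v, hv, hlt⟩ := (hpres _ hr).depth_lt hb ha
    rcases (hmem _ _).1 hvs with rfl | ⟨j, -, hlv⟩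
    · simp at hv
    have := (level_spec φ.2 hpres hlv).2.2 v hv
    exact (hmem _ _).2 (.inr ⟨j + 1, by omega, List.mem_flatMap.2 ⟨vs, hlv, hb⟩⟩)
  · refine (PolyBdd.add (.mul (.refl _) hm) (.const 1 _)).mono fun φ => ?_
    refine (Finset.card_insert_le _ _).trans (Nat.add_le_add_right ?_ 1)
    refine (Finset.card_biUnion_le_card_mul _ _ (m φ) fun j hj => ?_).trans ?_
    · exact (List.toFinset_card_le _).trans
        (hlev φ j (Nat.lt_succ_iff.1 (Finset.mem_range.1 hj)))
    · rw [Finset.card_range]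
      exact Nat.mul_le_mul_right _ (depth_le_size φ.1)

theorem LinearPres.nodup_flatten {φ : OSForm Λ.Mod (Var Λ.Mod)} {xs : List (List (Var Λ.Mod))}
    (hp : Λ.PresentsOSWsi φ xs) (hl : Λ.LinearPres φ xs) : xs.flatten.Nodup := by
  refine List.nodup_flatten.2 ⟨fun b hb => (hp.1 b hb).1, List.pairwise_iff_get.2 ?_⟩
  intro i j hij a hi hj
  exact hij.ne (hl a ((hp.1 _ (List.get_mem _ _)).2 a hi) i j hi hj)

theorem flatten_subset_vars {V : Type} {φ : OSForm Λ.Mod V} {xs : List (List V)}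
    (hp : Λ.PresentsOSWsi φ xs) : xs.flatten ⊆ φ.vars := by
  intro a ha
  obtain ⟨b, hb, hab⟩ := List.mem_flatten.1 ha
  exact (hp.1 b hb).2 a hab

theorem weight_flatten (xs : List (List (Var Λ.Mod))) :
    Λ.weight xs.flatten = (xs.map Λ.weight).sum := by
  induction xs with
  | nil => rfl
  | cons b xs ih => simp [weight_append, ih]

theorem LinearPres.length_le {φ : OSForm Λ.Mod (Var Λ.Mod)} {xs : List (List (Var Λ.Mod))}
    (hp : Λ.PresentsOSWsi φ xs) (hl : Λ.LinearPres φ xs) : xs.length ≤ (Λ.encOS φ).size + 1 := by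
  classical
  -- at most one entry is empty, and the others contain different variables
  have key : ∀ xs : List (List (Var Λ.Mod)), xs.length ≤ xs.flatten.length + xs.count [] := by
    intro xs
    induction xs with
    | nil => simp
    | cons b xs ih => rcases b with _ | ⟨a, b⟩ <;> simp at ih ⊢ <;> omega
  have h1 := key xs
  have h2 := List.nodup_iff_count_le_one.1 hp.nodup []
  have h3 : xs.flatten.length ≤ φ.vars.length :=
    (List.subperm_of_subset (hl.nodup_flatten hp) (flatten_subset_vars hp)).length_le
  have h4 : φ.vars.length ≤ (Λ.encOS φ).size := by
    rw [OSForm.vars, List.length_map]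
    exact length_le_encList _ _
  omega

/-- With linear one-step models, the total weight of the levels does not increase. -/
theorem admitsPolyWsiRel_of_linear {O : Dat → Dat}
    (hans : PolyTime O (fun B : {B // Relevant L B} => Λ.encOS (starConj sh B.1))
      fun B => Λ.encPres (ans B.1))
    (hpres : ∀ B, Relevant L B → Λ.PresentsOSWsi (starConj sh B) (ans B))
    (hlin : ∀ B, Relevant L B → Λ.LinearPres (starConj sh B) (ans B)) :
    Λ.AdmitsPolyWsiRel sh O L := by
  refine admitsPolyWsiRel_of_levels hans hpres
    ((PolyBdd.const 3 _).add (.refl fun φ : L => (Λ.encForm φ.1).size)) fun φ j _ => ?_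
  have hsum : ((level ans φ.1 j).map Λ.weight).sum ≤ 3 + (Λ.encForm φ.1).size := by
    clear * - φ hpres hlin
    induction j with
    | zero => simp [level, weight_root]
    | succ j ih =>
      refine le_trans ?_ ih
      rw [level, List.flatMap_def, ← weight_flatten, List.flatten_flatten, List.map_map]
      have : ∀ l : List (List (Var Λ.Mod)), (∀ vs ∈ l, Relevant L (vs.map Prod.snd)) →
          Λ.weight (l.map (List.flatten ∘ fun vs => ans (vs.map Prod.snd))).flatten ≤
            (l.map Λ.weight).sum := by
        intro l hl
        rw [weight_flatten, List.map_map]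
        refine List.sum_le_sum fun vs hvs => ?_
        have h := hl vs hvs
        exact (weight_le_of_nodup ((hlin _ h).nodup_flatten (hpres _ h))
          (flatten_subset_vars (hpres _ h))).trans (weight_vars_le vs)
      exact this _ fun vs hvs => (level_spec φ.2 hpres hvs).1
  refine le_trans ?_ hsum
  clear hsum
  induction level ans φ.1 j with
  | nil => simp
  | cons vs l ih =>
    rcases vs with _ | ⟨a, vs⟩
    · simp only [List.map_cons, List.sum_cons]
      simpa using ih.trans (Nat.le_add_left _ _)
    · simp only [List.map_cons, List.sum_cons, weight_cons]
      simp only [List.isEmpty_cons, Bool.not_false, List.filter_cons_of_pos, List.length_cons]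
      omega

/-- With one-step models of polynomial size, the levels grow by a polynomial factor, and there
are boundedly many. -/
theorem admitsPolyWsiRel_of_polynomial {O : Dat → Dat} {d : ℕ} (hd : ∀ φ ∈ L, φ.depth ≤ d)
    (hans : PolyTime O (fun B : {B // Relevant L B} => Λ.encOS (starConj sh B.1))
      fun B => Λ.encPres (ans B.1))
    (hpres : ∀ B, Relevant L B → Λ.PresentsOSWsi (starConj sh B) (ans B))
    {p : Polynomial ℕ} (hpoly : ∀ B, Relevant L B → Λ.PolyPres p (starConj sh B) (ans B)) :
    Λ.AdmitsPolyWsiRel sh O L := by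
  let q : L → ℕ := fun φ => p.eval (3 + (Λ.encForm φ.1).size) + 1
  have hq : PolyBdd q fun φ => (Λ.encForm φ.1).size :=
    (PolyBdd.trans (f' := fun φ : L => 3 + (Λ.encForm φ.1).size) ⟨p, fun _ => le_rfl⟩
      ((PolyBdd.const 3 _).add (.refl _))).add (.const 1 _)
  refine admitsPolyWsiRel_of_levels hans hpres (hq.pow d) fun φ j hj => ?_
  have key : (level ans φ.1 j).length ≤ q φ ^ j := by
    clear hj
    induction j with
    | zero => simp [level]
    | succ j ih =>
      rw [level, List.length_flatMap, pow_succ]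
      refine (List.sum_le_card_nsmul _ (q φ) ?_).trans ?_
      · intro n hn
        obtain ⟨vs, hvs, rfl⟩ := List.mem_map.1 hn
        obtain ⟨h1, h2, -⟩ := level_spec φ.2 hpres hvs
        exact ((hpoly _ h1).trans (polynomial_eval_mono p ((osSize_le_weight vs).trans h2))).trans
          (Nat.le_succ _)
      · rw [List.length_map, smul_eq_mul]
        exact Nat.mul_le_mul_right _ ih
  exact (List.length_filter_le _ _).trans (key.trans
    (Nat.pow_le_pow_right (Nat.succ_pos _) (hj.trans (hd _ φ.2))))

end Levels

/-! ### One-step procedures -/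

section Procedures

variable {L : Set (Form Λ.Mod)}
  {Q : OSForm Λ.Mod (Var Λ.Mod) → List (List (Var Λ.Mod)) → Prop}

theorem PresentsOSWsi.size_le {φ : OSForm Λ.Mod (Var Λ.Mod)} {xs : List (List (Var Λ.Mod))}
    (h : Λ.PresentsOSWsi φ xs) :
    (Λ.encPres xs).size ≤ 1 + xs.length * (1 + (Λ.encOS φ).size) := by
  refine encList_le_of_forall _ fun b hb => ?_
  rw [size_encVars]
  exact (Nat.add_le_add_left (weight_le_of_nodup (h.1 b hb).1 (h.1 b hb).2) 1).trans
    (weight_vars_le_encOS φ)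

/-- A one-step procedure with answers of polynomial length may be called as an oracle. -/
theorem ProvidesOSWsi.exists_answers {O : Dat → Dat} (hO : Λ.ProvidesOSWsi sh O L Q)
    (hlen : ∃ p : Polynomial ℕ, ∀ φ xs, Λ.PresentsOSWsi φ xs → Q φ xs →
      xs.length ≤ p.eval (Λ.encOS φ).size) :
    ∃ ans : List (Form Λ.Mod) → List (List (Var Λ.Mod)),
      (PolyTime O (fun B : {B // Relevant L B} => Λ.encOS (starConj sh B.1))
        fun B => Λ.encPres (ans B.1)) ∧
      (∀ B, Relevant L B → Λ.PresentsOSWsi (starConj sh B) (ans B)) ∧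
      ∀ B, Relevant L B → Q (starConj sh B) (ans B) := by
  choose! ans h1 h2 h3 using hO
  obtain ⟨p, hp⟩ := hlen
  refine ⟨ans, (PolyTime.ask .id ?_).congr (fun _ => rfl) fun B => h1 _ B.2, h2, h3⟩
  refine ((PolyBdd.const 1 _).add (.mul ⟨p, fun _ => le_rfl⟩
    ((PolyBdd.const 1 _).add (.refl _)))).mono fun B => ?_
  rw [h1 _ B.2]
  exact (h2 _ B.2).size_le.trans (Nat.add_le_add_left (Nat.mul_le_mul_right _
    (hp _ _ (h2 _ B.2) (h3 _ B.2))) 1)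

theorem OSWsiInPolyTime.exists_answers (h : Λ.OSWsiInPolyTime sh L Q) :
    ∃ ans : List (Form Λ.Mod) → List (List (Var Λ.Mod)),
      (PolyTime noOracle (fun B : {B // Relevant L B} => Λ.encOS (starConj sh B.1))
        fun B => Λ.encPres (ans B.1)) ∧
      (∀ B, Relevant L B → Λ.PresentsOSWsi (starConj sh B) (ans B)) ∧
      ∀ B, Relevant L B → Q (starConj sh B) (ans B) := by
  obtain ⟨P, p, hP⟩ := h
  have : ∀ B, Relevant L B → ∃ (xs : List (List (Var Λ.Mod))) (c : ℕ),
      Eval noOracle P [Λ.encOS (starConj sh B)] (.call 0 (.var 0)) (Λ.encPres xs) c ∧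
      c ≤ p.eval (Λ.encOS (starConj sh B)).size ∧
      Λ.PresentsOSWsi (starConj sh B) xs ∧ Q (starConj sh B) xs := by
    intro B hB
    obtain ⟨v, c, hv, hc, hR⟩ := hP _ ⟨B, hB, rfl⟩
    obtain ⟨xs, rfl, h1, h2⟩ := hR B hB rfl
    exact ⟨xs, c, hv, hc, h1, h2⟩
  choose! ans c h1 h2 h3 h4 using this
  exact ⟨ans, ⟨P, _, fun B => c B.1, fun B => h1 _ B.2, p, fun B => h2 _ B.2⟩, h3, h4⟩

/-- A one-step procedure exists as soon as suitable one-step models exist. -/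
theorem exists_oracle (Λ : ModalStructure T)
    (Q : OSForm Λ.Mod (Var Λ.Mod) → List (List (Var Λ.Mod)) → Prop) :
    ∃ O : Dat → Dat, ∀ φ, (∃ xs, Λ.PresentsOSWsi φ xs ∧ Q φ xs) →
      ∃ xs, O (Λ.encOS φ) = Λ.encPres xs ∧ Λ.PresentsOSWsi φ xs ∧ Q φ xs := by
  have : ∀ x : Dat, ∃ v : Dat, ∀ φ, Λ.encOS φ = x → (∃ xs, Λ.PresentsOSWsi φ xs ∧ Q φ xs) →
      ∃ xs, v = Λ.encPres xs ∧ Λ.PresentsOSWsi φ xs ∧ Q φ xs := by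
    intro x
    by_cases h : ∃ φ, Λ.encOS φ = x ∧ ∃ xs, Λ.PresentsOSWsi φ xs ∧ Q φ xs
    · obtain ⟨φ, rfl, xs, h1, h2⟩ := h
      refine ⟨Λ.encPres xs, fun φ' hφ' _ => ?_⟩
      obtain rfl := encOS_injective hφ'
      exact ⟨xs, rfl, h1, h2⟩
    · exact ⟨.nil, fun φ hφ hx => (h ⟨φ, hφ, hx⟩).elim⟩
  choose O hO using this
  exact ⟨O, fun φ h => hO _ φ rfl h⟩

/-- Every one-step wsi model has a presentation, in which only those sets of variables occur
that are realized in the given model. -/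
theorem IsOSWsi.exists_presents {V X : Type} {τ : V → Set X} {t : T X} {φ : OSForm Λ.Mod V}
    (H : Λ.IsOSWsi τ t φ) : ∃ xs, Λ.PresentsOSWsi φ xs ∧
      ∀ b ∈ xs, ∃ x, ∀ a, a ∈ b ↔ a ∈ φ.vars ∧ x ∈ τ a := by
  classical
  let f : X → List V := fun x => φ.vars.dedup.filter (x ∈ τ ·)
  have hf : ∀ x a, a ∈ f x ↔ a ∈ φ.vars ∧ x ∈ τ a := fun x a => by simp [f]
  let xs : List (List V) := φ.vars.dedup.sublists.filter (∃ x, f x = ·)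
  have hxs : ∀ b, b ∈ xs ↔ ∃ x, f x = b := by
    intro b
    simp only [xs, List.mem_filter, List.mem_sublists, decide_eq_true_eq, and_iff_right_iff_imp]
    rintro ⟨x, rfl⟩
    exact List.filter_sublist
  refine ⟨xs, H.presents ?_ ?_ fun x => ⟨f x, (hxs _).2 ⟨x, rfl⟩, fun a ha => ?_⟩, ?_⟩
  · intro b hb
    obtain ⟨x, rfl⟩ := (hxs b).1 hb
    exact ⟨(List.nodup_dedup _).filter _, fun a ha => ((hf x a).1 ha).1⟩
  · intro i j hij
    have hnd : xs.Nodup := (List.nodup_sublists.2 (List.nodup_dedup _)).filter _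
    refine List.nodup_iff_injective_get.1 hnd ?_
    obtain ⟨x, hx⟩ := (hxs _).1 (List.get_mem xs i)
    obtain ⟨y, hy⟩ := (hxs _).1 (List.get_mem xs j)
    rw [← hx, ← hy] at hij ⊢
    refine List.filter_congr fun a ha => ?_
    have := hij a
    rw [hf, hf] at this
    have ha' := List.mem_dedup.1 ha
    simpa [ha'] using this
  · rw [hf]; exact and_iff_right ha
  · intro b hb
    obtain ⟨x, rfl⟩ := (hxs b).1 hb
    exact ⟨x, hf x⟩

theorem AdmitsLinear.exists_oracle (h : Λ.AdmitsLinear sh L) :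
    ∃ O, Λ.ProvidesOSWsi sh O L Λ.LinearPres := by
  obtain ⟨O, hO⟩ := ModalStructure.exists_oracle Λ Λ.LinearPres
  refine ⟨O, fun B hB => hO _ ?_⟩
  obtain ⟨X, τ, t, hw, hlin⟩ := h B hB
  obtain ⟨xs, hp, hxs⟩ := hw.exists_presents
  refine ⟨xs, hp, fun a ha i j hi hj => hp.2.1 i j fun a' => ?_⟩
  obtain ⟨x, hx⟩ := hxs _ (List.get_mem xs i)
  obtain ⟨y, hy⟩ := hxs _ (List.get_mem xs j)
  obtain rfl := Set.encard_le_one_iff.1 (hlin a ha) x y ((hx a).1 hi).2 ((hy a).1 hj).2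
  rw [hx, hy]

theorem AdmitsPolynomial.exists_oracle (h : Λ.AdmitsPolynomial) :
    ∃ O p, ∀ L : Set (Form Λ.Mod), Λ.ProvidesOSWsi sh O L (Λ.PolyPres p) := by
  obtain ⟨p, hp⟩ := h
  obtain ⟨O, hO⟩ := ModalStructure.exists_oracle Λ (Λ.PolyPres p)
  refine ⟨O, p, fun L B _ => hO _ ?_⟩
  obtain ⟨X, τ, t, hw, hfin, hcard⟩ := hp _ (starConj sh B)
  obtain ⟨xs, hpr, hxs⟩ := hw.exists_presents
  refine ⟨xs, hpr, le_trans ?_ hcard⟩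
  choose f hf using fun i : Fin xs.length => hxs _ (List.get_mem xs i)
  have hinj : Function.Injective f := fun i j hij => hpr.2.1 i j fun a => by
    rw [hf, hf, hij]
  simpa using Nat.card_le_card_of_injective f hinj

end Procedures

/-! ### Bounded one-step models -/

/-- The subsets with at most `k` elements of the set of members of `l`, each listed in the order
of `l`. -/
noncomputable def smallSubsets {α : Type} (l : List α) : ℕ → List (List α)
  | 0 => [[]]
  | k + 1 => listUnion
      (l.flatMap fun a => (smallSubsets l k).map fun b => listInter l (a :: b)) (smallSubsets l k)

section SmallSubsets

variable {α : Type} {l : List α} {k : ℕ} {b : List α}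

theorem mem_smallSubsets_succ : b ∈ smallSubsets l (k + 1) ↔
    (∃ a ∈ l, ∃ b' ∈ smallSubsets l k, listInter l (a :: b') = b) ∨ b ∈ smallSubsets l k := by
  simp [smallSubsets, mem_listUnion]

theorem nodup_smallSubsets (k : ℕ) : (smallSubsets l k).Nodup := by
  induction k with
  | zero => simp [smallSubsets]
  | succ k ih => exact nodup_listUnion _ ih

theorem listInter_of_mem_smallSubsets (h : b ∈ smallSubsets l k) : ∃ s, b = listInter l s := by
  induction k with
  | zero =>
    obtain rfl : b = [] := by simpa [smallSubsets] using h
    exact ⟨[], by simp [listInter]⟩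
  | succ k ih =>
    rcases mem_smallSubsets_succ.1 h with ⟨a, -, b', -, rfl⟩ | h
    · exact ⟨_, rfl⟩
    · exact ih h

theorem length_le_of_mem_smallSubsets (hl : l.Nodup) (h : b ∈ smallSubsets l k) :
    b.length ≤ k := by
  induction k generalizing b with
  | zero =>
    obtain rfl : b = [] := by simpa [smallSubsets] using h
    simp
  | succ k ih =>
    rcases mem_smallSubsets_succ.1 h with ⟨a, -, b', hb', rfl⟩ | h
    · have := (List.subperm_of_subset (nodup_listInter hl (a :: b'))
        fun x hx => (mem_listInter.1 hx).2).length_le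
      exact this.trans (Nat.succ_le_succ (ih hb'))
    · exact (ih h).trans (Nat.le_succ k)

theorem exists_mem_smallSubsets (s : List α) (hs : s.length ≤ k) :
    ∃ b ∈ smallSubsets l k, ∀ a ∈ l, a ∈ b ↔ a ∈ s := by
  induction k generalizing s with
  | zero =>
    obtain rfl : s = [] := by simpa using hs
    exact ⟨[], by simp [smallSubsets], by simp⟩
  | succ k ih =>
    rcases s with _ | ⟨c, s⟩
    · obtain ⟨b, hb, h⟩ := ih [] (Nat.zero_le _)
      exact ⟨b, mem_smallSubsets_succ.2 (.inr hb), h⟩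
    · obtain ⟨b, hb, h⟩ := ih s (by simpa using hs)
      by_cases hc : c ∈ l
      · refine ⟨_, mem_smallSubsets_succ.2 (.inl ⟨c, hc, b, hb, rfl⟩), fun a ha => ?_⟩
        rw [mem_listInter, List.mem_cons, List.mem_cons, h a ha]
        exact and_iff_right ha
      · refine ⟨b, mem_smallSubsets_succ.2 (.inr hb), fun a ha => ?_⟩
        rw [h a ha, List.mem_cons]
        exact (or_iff_right fun hac : a = c => hc (hac ▸ ha)).symm

theorem polyTime_smallSubsets {O : Dat → Dat} {ι : Type} {x : ι → Dat} {e : α → Dat}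
    (he : Function.Injective e) {l : ι → List α} (hl : PolyTime O x fun i => encList e (l i))
    (k : ℕ) : PolyTime O x fun i => encList (encList e) (smallSubsets (l i) k) := by
  induction k with
  | zero => exact PolyTime.nil.cons .nil
  | succ k ih =>
    refine PolyTime.union (encList_injective he) (PolyTime.flatMap e (encList e)
      (f := fun i a => (smallSubsets (l i) k).map fun b => listInter (l i) (a :: b)) hl ?_) ih
    refine PolyTime.map (encList e) (encList e)
      (f := fun (q : {q : ι × α // q.2 ∈ l q.1}) b => listInter (l q.1.1) (q.1.2 :: b))
      ((ih.reindex fun q : {q : ι × α // q.2 ∈ l q.1} => q.1.1).of_fst _) ?_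
    exact PolyTime.inter he (((hl.reindex _).of_fst _).of_fst _)
      (PolyTime.id.fst.snd.cons PolyTime.id.snd)

end SmallSubsets

/-- The variables that occur at any depth in the decomposition of a formula. -/
noncomputable def subVars {M : Type} (sh : Bool) : Form M → Finset (Var M)
  | .top => ∅
  | .and φ ψ => by classical exact subVars sh φ ∪ subVars sh ψ
  | .mod h φ => by classical exact insert (mkVar sh h φ) (subVars sh φ)

theorem card_subVars_le (φ : Form Λ.Mod) : (subVars sh φ).card ≤ (Λ.encForm φ).size := by
  classical
  induction φ with
  | top => simp [subVars]
  | and φ ψ ih1 ih2 =>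
    simp only [subVars]
    refine (Finset.card_union_le _ _).trans ?_
    simp only [encForm, Dat.size]; omega
  | mod h φ ih =>
    simp only [subVars]
    refine (Finset.card_insert_le _ _).trans ?_
    simp only [encForm, Dat.size]; omega

theorem vars_star_subset_subVars {M : Type} {φ : Form M} {a : Var M}
    (h : a ∈ OSForm.vars (φ.star sh)) : a ∈ subVars sh φ := by
  induction φ with
  | top => simp [Form.star, OSForm.vars] at h
  | and φ ψ ih1 ih2 =>
    rw [OSForm.vars, Form.star, List.map_append, List.mem_append] at h
    simp only [subVars, Finset.mem_union]
    exact h.imp ih1 ih2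
  | mod m φ =>
    simp only [subVars, Finset.mem_insert]
    exact .inl (by simpa [Form.star, OSForm.vars] using h)

theorem subVars_subset {M : Type} {φ : Form M} {a : Var M} (h : a ∈ subVars sh φ) :
    subVars sh a.2 ⊆ subVars sh φ := by
  induction φ with
  | top => simp [subVars] at h
  | and φ ψ ih1 ih2 =>
    simp only [subVars, Finset.mem_union] at h
    intro b hb
    simp only [subVars, Finset.mem_union]
    exact h.imp (fun h => ih1 h hb) fun h => ih2 h hb
  | mod m φ ih =>
    simp only [subVars, Finset.mem_insert] at h
    intro b hb
    simp only [subVars, Finset.mem_insert]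
    rcases h with rfl | h
    · exact .inr hb
    · exact .inr (ih h hb)

/-- There are only polynomially many lists of bounded length over a finite set. -/
theorem exists_finset_lists {α : Type} (V : Finset α) (k : ℕ) :
    ∃ S : Finset (List α), (∀ l, l ∈ S ↔ l.length ≤ k ∧ ∀ a ∈ l, a ∈ V) ∧
      S.card ≤ (1 + V.card) ^ k := by
  classical
  induction k with
  | zero => exact ⟨{[]}, by rintro (_ | _) <;> simp, by simp⟩
  | succ k ih =>
    obtain ⟨S, hS, hc⟩ := ih
    refine ⟨insert [] (Finset.image₂ List.cons V S), ?_, ?_⟩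
    · rintro (_ | ⟨a, l⟩)
      · simp
      · simp [hS, and_left_comm]
    · refine (Finset.card_insert_le _ _).trans ?_
      have h1 : (Finset.image₂ List.cons V S).card ≤ V.card * (1 + V.card) ^ k :=
        (Finset.card_image₂_le _ _ _).trans (Nat.mul_le_mul_left _ hc)
      have h2 : 1 ≤ (1 + V.card) ^ k := Nat.one_le_pow _ _ (by omega)
      have h3 : (1 + V.card) ^ (k + 1) = (1 + V.card) ^ k + V.card * (1 + V.card) ^ k := by ring
      omega

theorem polyTime_vars (O : Dat → Dat) :
    PolyTime O (fun φ : OSForm Λ.Mod (Var Λ.Mod) => Λ.encOS φ)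
      fun φ => encList Λ.encVar φ.vars :=
  PolyTime.map (encPair Λ.code Λ.encVar) Λ.encVar (l := fun φ => φ) .id PolyTime.id.snd.snd

/-- If there are `k`-bounded one-step wsi models at all, then the sets of at most `k` variables
form one. -/
theorem AdmitsBounded.presents {L : Set (Form Λ.Mod)} {k : ℕ} (h : Λ.AdmitsBounded sh k L)
    {B : List (Form Λ.Mod)} (hB : Relevant L B) : Λ.PresentsOSWsi (starConj sh B)
      (smallSubsets (listUnion (OSForm.vars (starConj sh B)) []) k) := by
  obtain ⟨X, τ, t, hw, hk⟩ := h B hB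
  have hV : ∀ a, a ∈ listUnion (OSForm.vars (starConj sh B)) [] ↔
      a ∈ OSForm.vars (starConj sh B) := fun a => by simp [mem_listUnion]
  have hVn := nodup_listUnion (OSForm.vars (starConj sh B)) List.nodup_nil
  refine hw.presents ?_ ?_ fun x => ?_
  · intro b hb
    obtain ⟨s, rfl⟩ := listInter_of_mem_smallSubsets hb
    exact ⟨nodup_listInter hVn s, fun a ha => (hV a).1 (mem_listInter.1 ha).1⟩
  · intro i j hij
    refine List.nodup_iff_injective_get.1 (nodup_smallSubsets k) ?_
    obtain ⟨s, hs⟩ := listInter_of_mem_smallSubsets (List.get_mem _ i)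
    obtain ⟨s', hs'⟩ := listInter_of_mem_smallSubsets (List.get_mem _ j)
    rw [hs, hs'] at hij ⊢
    refine List.filter_congr fun a ha => ?_
    have := hij a
    rw [mem_listInter, mem_listInter, and_iff_right ha, and_iff_right ha] at this
    simpa using this
  · have hfin := Set.finite_of_encard_le_coe (hk x)
    obtain ⟨b, hb, h⟩ := exists_mem_smallSubsets
      (l := listUnion (OSForm.vars (starConj sh B)) []) (k := k) hfin.toFinset.toList (by
        rw [Finset.length_toList]
        have := hk x
        rw [hfin.encard_eq_coe_toFinset_card] at this
        exact_mod_cast this)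
    refine ⟨b, hb, fun a ha => (h a ((hV a).2 ha)).trans ?_⟩
    rw [Finset.mem_toList, Set.Finite.mem_toFinset]
    exact and_iff_right ha

theorem AdmitsBounded.admitsPolyWsi {L : Set (Form Λ.Mod)} {k : ℕ}
    (h : Λ.AdmitsBounded sh k L) : Λ.AdmitsPolyWsi sh L := by
  classical
  choose S' hS' hcard using fun φ : L => exists_finset_lists (subVars sh φ.1) k
  refine admitsPolyWsiRel_of_procedure
    (ans := fun B => smallSubsets (listUnion (OSForm.vars (starConj sh B)) []) k)
    ?_ (fun B hB => h.presents hB) (fun φ => insert [(none, φ.1)] (S' φ))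
    (fun φ => Finset.mem_insert_self _ _) ?_ ?_
  · exact polyTime_smallSubsets encVar_injective (PolyTime.union encVar_injective
      ((polyTime_vars noOracle).reindex
        fun B : {B // Relevant L B} => starConj sh B.1) .nil) k
  · intro φ vs hvs hr b hb
    refine Finset.mem_insert_of_mem ((hS' φ b).2 ⟨length_le_of_mem_smallSubsets
      (nodup_listUnion _ List.nodup_nil) hb, fun a ha => ?_⟩)
    obtain ⟨χ, hχ, ha'⟩ := mem_vars_starConj.1 (((h.presents hr).1 b hb).2 a ha)
    obtain ⟨v, hv, rfl⟩ := List.mem_map.1 hχ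
    have ha'' := vars_star_subset_subVars ha'
    rcases Finset.mem_insert.1 hvs with rfl | hvs
    · obtain rfl : v = (none, φ.1) := by simpa using hv
      exact ha''
    · exact subVars_subset (((hS' φ vs).1 hvs).2 v hv) ha''
  · refine ((((PolyBdd.const 1 _).add (.refl _)).pow k).add (.const 1 _)).mono fun φ => ?_
    refine (Finset.card_insert_le _ _).trans (Nat.add_le_add_right ((hcard φ).trans ?_) 1)
    exact Nat.pow_le_pow_left (Nat.add_le_add_left (card_subVars_le φ.1) 1) k

end ModalStructure
end CoalgLogic

theorem mainTheorem7 (T : Type → Type) [Functor T] [LawfulFunctor T]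
    (Λ : CoalgLogic.ModalStructure T) (sh : Bool) :
    -- fragments with linear one-step wsi models
    (∀ L : Set (CoalgLogic.Form Λ.Mod), Λ.AdmitsLinear sh L →
      (∃ O, Λ.ProvidesOSWsi sh O L Λ.LinearPres) ∧
      (∀ O, Λ.ProvidesOSWsi sh O L Λ.LinearPres → Λ.AdmitsPolyWsiRel sh O L) ∧
      (Λ.OSWsiInPolyTime sh L Λ.LinearPres → Λ.AdmitsPolyWsi sh L)) ∧
    -- fragments with `k`-bounded one-step wsi models
    (∀ (L : Set (CoalgLogic.Form Λ.Mod)) (k : ℕ), Λ.AdmitsBounded sh k L → Λ.AdmitsPolyWsi sh L) ∧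
    -- polynomial one-step wsi models and bounded modal depth
    (Λ.AdmitsPolynomial →
      (∃ O p, ∀ d, Λ.ProvidesOSWsi sh O (Λ.depthFragment d) (Λ.PolyPres p)) ∧
      ∀ d : ℕ,
        (∀ O p, Λ.ProvidesOSWsi sh O (Λ.depthFragment d) (Λ.PolyPres p) →
          Λ.AdmitsPolyWsiRel sh O (Λ.depthFragment d)) ∧
        ((∃ p, Λ.OSWsiInPolyTime sh (Λ.depthFragment d) (Λ.PolyPres p)) →
          Λ.AdmitsPolyWsi sh (Λ.depthFragment d))) := by
  refine ⟨fun L hL => ⟨hL.exists_oracle, fun O hO => ?_, fun h => ?_⟩,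
    fun L k h => h.admitsPolyWsi, fun hΛ => ⟨?_, fun d => ⟨fun O p hO => ?_, fun ⟨p, h⟩ => ?_⟩⟩⟩
  · obtain ⟨ans, h1, h2, h3⟩ := hO.exists_answers ⟨Polynomial.X + 1, fun φ xs hp hl => by
      simpa using hl.length_le hp⟩
    exact CoalgLogic.ModalStructure.admitsPolyWsiRel_of_linear h1 h2 h3
  · obtain ⟨ans, h1, h2, h3⟩ := h.exists_answers
    exact CoalgLogic.ModalStructure.admitsPolyWsiRel_of_linear h1 h2 h3
  · obtain ⟨O, p, h⟩ := hΛ.exists_oracle (sh := sh)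
    exact ⟨O, p, fun d => h _⟩
  · obtain ⟨ans, h1, h2, h3⟩ := hO.exists_answers ⟨p, fun φ xs _ hl =>
      le_trans hl (CoalgLogic.polynomial_eval_mono p (CoalgLogic.ModalStructure.osSize_le_encOS φ))⟩
    exact CoalgLogic.ModalStructure.admitsPolyWsiRel_of_polynomial (fun _ h => h) h1 h2 h3
  · obtain ⟨ans, h1, h2, h3⟩ := h.exists_answers
    exact CoalgLogic.ModalStructure.admitsPolyWsiRel_of_polynomial (fun _ h => h) h1 h2 h3
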